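/- Let $M=T^4=(S^1)^4$, $S^1=\mathbb R/2\pi\mathbb Z$, with angles $\theta_1,\dots,\theta_4$, let $\eta=d\theta_3\wedge d\theta_4$, let $G$ be the span of $\partial_{\theta_3},\partial_{\theta_4}$, and let $\pi=\partial_{\theta_3}\wedge\partial_{\theta_4}$. Notation. A closed 2-form $\zeta$ is pre-symplectic of rank $k$ if $\zeta^\sharp\colon TM\to T^*M$, $v\mapsto\zeta(v,\cdot)$, has constant rank $k$. Put $K=\ker\eta^\sharp$, and let $\Omega_{\mathrm{hor}}(M)$ be the space of smooth forms whose restriction to $K$ vanishes, with cohomology $H^k_{\mathrm{hor}}=\{\text{closed horizontal }k\text{-forms}\}/d\Omega^{k-1}_{\mathrm{hor}}(M)$. For a bivector field $Z$ let $\mathcal L_Z=\iota_Z d-d\,\iota_Z$ (with $\iota_{X\wedge Y}=\iota_X\iota_Y$) and $$[\alpha,\beta]_Z=(-1)^{|\alpha|+1}\big(\mathcal L_Z(\alpha\wedge\beta)-\mathcal L_Z(\alpha)\wedge\beta-(-1)^{|\alpha|}\alpha\wedge\mathcal L_Z(\beta)\big).$$ The Koszul $L_\infty[1]$-algebra of $(M,\eta)$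 is $\Omega_{\mathrm{hor}}(M)[2]$ with $\lambda_1=d$, $\lambda_2(\alpha,\beta)=(-1)^{|\alpha|}[\alpha,\beta]_\pi$ and $\lambda_3(\alpha,\beta,\gamma)=(-1)^{|\beta|+1}(\alpha^\sharp\wedge\beta^\sharp\wedge\gamma^\sharp)(\tfrac12[\pi,\pi])$, where $(\alpha^\sharp\wedge\beta^\sharp\wedge\gamma^\sharp)(v_1\wedge v_2\wedge v_3)=\sum_{\sigma\in S_3}\mathrm{sgn}(\sigma)\,\iota_{v_{\sigma(1)}}\alpha\wedge\iota_{v_{\sigma(2)}}\beta\wedge\iota_{v_{\sigma(3)}}\gamma$. Its $H^0$ and $H^1$ are $H^2_{\mathrm{hor}}$ and $H^3_{\mathrm{hor}}$. A Maurer–Cartan element is a $\beta\in\Omega^2_{\mathrm{hor}}(M)$ with $d\beta+\tfrac12\lambda_2(\beta,\beta)+\tfrac16\lambda_3(\beta,\beta,\beta)=0$; a formal curve of Maurer–Cartan elements is a series $\sum_{n\ge1}w_nt^n$, $w_n\in\Omega^2_{\mathrm{hor}}(M)$, satisfying this equation coefficientwise. Claim. (1) $\eta$ is pre-symplectic of rank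 2, $K$ is spanned by $\partial_{\theta_1},\partial_{\theta_2}$, $TM=K\oplus G$, and $\pi\in\Gamma(\wedge^2G)$ satisfies $\pi^\sharp=-(\eta^\sharp|_G)^{-1}$. (2) The Kuranishi map $\mathrm{Kr}\colon H^2_{\mathrm{hor}}\to H^3_{\mathrm{hor}}$, $[w]\mapsto[\lambda_2(w,w)]$, is well defined. (3) For all smooth $f,g\colon S^1\to\mathbb R$, the form $B=f(\theta_3)\,d\theta_1\wedge d\theta_3+g(\theta_4)\,d\theta_2\wedge d\theta_4$ is closed and horizontal, $$\lambda_2(B,B)=[B,B]_\pi=2\big(f(\theta_3)g'(\theta_4)\,d\theta_1\wedge d\theta_2\wedge d\theta_4+g(\theta_4)f'(\theta_3)\,d\theta_1\wedge d\theta_2\wedge d\theta_3\big),$$ this 3-form is exact in $\Omega(M)$, and $\mathrm{Kr}([B])\ne0$ whenever $g(0)(f(b)-f(a))\neq0$ for some $a,b\in S^1$. (4) For $f=g=\cos$, that is $B=\cos(\theta_3)\,d\theta_1\wedge d\theta_3+\cos(\theta_4)\,d\theta_2\wedge d\theta_4$, one has $\mathrm{Kr}([B])\neq0$, and the infinitesimal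 deformation $[B]$ is formally and smoothly obstructed. That is, for every closed horizontal 2-form $w$ with $[w]=[B]$ in $H^2_{\mathrm{hor}}$: (a) there is no formal curve of Maurer–Cartan elements $\sum_{n\ge1}w_nt^n$ with $w_1=w$; (b) there are no $\varepsilon>0$ and smooth family $(\beta_t)_{t\in[0,\varepsilon)}$ of Maurer–Cartan elements with $\beta_0=0$ and $\frac{d}{dt}\big|_{t=0}\beta_t=w$; (c) there are no $\varepsilon>0$ and smooth family $(\eta_t)_{t\in[0,\varepsilon)}$ of pre-symplectic forms of rank 2 with $\eta_0=\eta$ and $\frac{d}{dt}\big|_{t=0}\eta_t=w$. -/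

import Mathlib

open scoped ContDiff

noncomputable section

namespace KoszulTorus

/-! ### Differential forms on the torus `T⁴ = (S¹)⁴`, `S¹ = ℝ / 2πℤ`

The covering `proj : ℝ⁴ → T⁴` is a local diffeomorphism, and its derivative identifies every tangent
space of `T⁴` with `ℝ⁴` (the frame `∂/∂θ₁, …, ∂/∂θ₄`). The angles `θ₁, …, θ₄` are indexed by
`0, …, 3`. -/

/-- The circle `S¹ = ℝ / 2πℤ`. -/
abbrev S1 : Type := AddCircle (2 * Real.pi)

/-- The four-dimensional torus. -/
abbrev T4 : Type := Fin 4 → S1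

/-- The tangent space of `T⁴` at any point. -/
abbrev V : Type := Fin 4 → ℝ

/-- The coordinate vector `∂/∂θᵢ`. -/
def e (i : Fin 4) : V := Pi.single i 1

/-- The universal covering `ℝ⁴ → T⁴`. -/
def proj (x : V) : T4 := fun i => (x i : S1)

lemma proj_surjective : Function.Surjective proj := by
  intro q
  choose x hx using fun i => QuotientAddGroup.mk_surjective (q i)
  exact ⟨x, funext hx⟩

/-- A point of `ℝ⁴` above a given point of `T⁴`. -/
def lift (q : T4) : V := Function.surjInv proj_surjective q

lemma proj_lift (q : T4) : proj (lift q) = q := Function.surjInv_eq proj_surjective q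

lemma proj_add_of_eq {x y : V} (h : proj x = proj y) (z : V) :
    proj (z + (y - x)) = proj z := by
  funext i
  have hi : (x i : S1) = (y i : S1) := congrFun h i
  simp [proj, hi]

/-- The derivative of the lift of a map on `T⁴` depends only on the point of `T⁴`. -/
lemma fderiv_proj {W : Type*} [NormedAddCommGroup W] [NormedSpace ℝ W] (F : T4 → W) (x : V) :
    fderiv ℝ (fun z => F (proj z)) (lift (proj x)) = fderiv ℝ (fun z => F (proj z)) x := by
  have h : proj x = proj (lift (proj x)) := (proj_lift _).symm
  have h1 := fderiv_comp_add_right (𝕜 := ℝ) (f := fun z => F (proj z)) (x := x)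
    (lift (proj x) - x)
  have h2 : (fun z => F (proj (z + (lift (proj x) - x)))) = fun z => F (proj z) :=
    funext fun z => congrArg F (proj_add_of_eq h z)
  rw [h2] at h1
  rw [h1]
  congr 1
  abel

/-- Alternating `k`-forms on the tangent space. -/
abbrev Alt (k : ℕ) : Type := V [⋀^Fin k]→L[ℝ] ℝ

/-- The algebra `C^∞(T⁴)`. -/
def smoothFun : Subalgebra ℝ (T4 → ℝ) where
  carrier := {f | ContDiff ℝ ∞ (fun x => f (proj x))}
  mul_mem' {f g} (hf : ContDiff ℝ ∞ _) (hg : ContDiff ℝ ∞ _) := by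
    change ContDiff ℝ ∞ (fun x => f (proj x) * g (proj x))
    exact hf.mul hg
  add_mem' {f g} (hf : ContDiff ℝ ∞ _) (hg : ContDiff ℝ ∞ _) := by
    change ContDiff ℝ ∞ (fun x => f (proj x) + g (proj x))
    exact hf.add hg
  algebraMap_mem' c := by
    change ContDiff ℝ ∞ (fun _ : V => c)
    exact contDiff_const

/-- The space `Ω^k(T⁴)` of smooth differential `k`-forms. -/
def formSpace (k : ℕ) : Submodule ℝ (T4 → Alt k) where
  carrier := {om | ContDiff ℝ ∞ (fun x => om (proj x))}
  zero_mem' := by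
    change ContDiff ℝ ∞ (fun _ : V => (0 : Alt k))
    exact contDiff_const
  add_mem' {a b} (ha : ContDiff ℝ ∞ _) (hb : ContDiff ℝ ∞ _) := by
    change ContDiff ℝ ∞ (fun x => a (proj x) + b (proj x))
    exact ha.add hb
  smul_mem' c a (ha : ContDiff ℝ ∞ _) := by
    change ContDiff ℝ ∞ (fun x => c • a (proj x))
    exact ha.const_smul c

/-- A smooth differential `k`-form on `T⁴`. -/
def Form (k : ℕ) : Type := formSpace k

instance (k : ℕ) : AddCommGroup (Form k) := (formSpace k).addCommGroup

instance (k : ℕ) : Module ℝ (Form k) := (formSpace k).module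


lemma Form.smooth {k : ℕ} (om : Form k) : ContDiff ℝ ∞ (fun x => om.1 (proj x)) := om.2

lemma smul_smooth {k : ℕ} {f : T4 → ℝ} (hf : f ∈ smoothFun) {om : T4 → Alt k}
    (hom : om ∈ formSpace k) : (fun q => f q • om q) ∈ formSpace k := by
  have hf' : ContDiff ℝ ∞ (fun x => f (proj x)) := hf
  have hom' : ContDiff ℝ ∞ (fun x => om (proj x)) := hom
  change ContDiff ℝ ∞ (fun x => f (proj x) • om (proj x))
  exact hf'.smul hom'

lemma const_smooth {k : ℕ} (a : Alt k) : (fun _ => a) ∈ formSpace k := by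
  change ContDiff ℝ ∞ (fun _ : V => a)
  exact contDiff_const

/-! ### de Rham differential -/

lemma extDeriv_lift_proj {k : ℕ} (om : T4 → Alt k) (x : V) :
    extDeriv (fun z => om (proj z)) (lift (proj x)) = extDeriv (fun z => om (proj z)) x := by
  unfold extDeriv
  rw [fderiv_proj]

lemma contDiff_extDeriv {k : ℕ} {om : V → Alt k} (h : ContDiff ℝ ∞ om) :
    ContDiff ℝ ∞ (extDeriv om) := by
  have h1 : ContDiff ℝ ∞ (fderiv ℝ om) := h.fderiv_right (by simp)
  exact (ContinuousAlternatingMap.alternatizeUncurryFinCLM ℝ V ℝ (n := k)).contDiff.comp h1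

/-- The de Rham differential `d : Ω^k(T⁴) → Ω^{k+1}(T⁴)`. -/
def d {k : ℕ} : Form k →ₗ[ℝ] Form (k + 1) where
  toFun om := ⟨fun q => extDeriv (fun x => om.1 (proj x)) (lift q), by
    have h := contDiff_extDeriv om.smooth
    change ContDiff ℝ ∞ _
    simpa only [extDeriv_lift_proj] using h⟩
  map_add' om om' := by
    refine Subtype.ext (funext fun q => ?_)
    exact extDeriv_add (om.smooth.differentiable (by simp)).differentiableAt
      (om'.smooth.differentiable (by simp)).differentiableAt
  map_smul' c om := by
    refine Subtype.ext (funext fun q => ?_)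
    exact extDeriv_smul c _

/-- In the coordinates `θᵢ`, `d` is the usual exterior derivative. -/
lemma d_apply_proj {k : ℕ} (om : Form k) (x : V) :
    (d om).1 (proj x) = extDeriv (fun z => om.1 (proj z)) x :=
  extDeriv_lift_proj om.1 x

/-! ### Wedge product -/

/-- `(α ⊗ β)(v₁, …, v_{r+s}) = α(v₁, …, v_r) β(v_{r+1}, …, v_{r+s})`. -/
def tensorAlt {r s n : ℕ} (h : r + s = n) (α : Alt r) (β : Alt s) :
    ContinuousMultilinearMap ℝ (fun _ : Fin n => V) ℝ where
  toMultilinearMap :=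
    ((LinearMap.mul' ℝ ℝ).compMultilinearMap
      (α.toMultilinearMap.domCoprod β.toMultilinearMap)).domDomCongr
        (finSumFinEquiv.trans (finCongr h))
  cont := by
    change Continuous fun v : Fin n → V =>
      α (fun i => v (finCongr h (finSumFinEquiv (Sum.inl i)))) *
        β (fun i => v (finCongr h (finSumFinEquiv (Sum.inr i))))
    exact (α.cont.comp (by fun_prop)).mul (β.cont.comp (by fun_prop))

lemma tensorAlt_apply {r s n : ℕ} (h : r + s = n) (α : Alt r) (β : Alt s) (v : Fin n → V) :
    tensorAlt h α β v = α (fun i => v (Fin.cast h (Fin.castAdd s i))) *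
      β (fun i => v (Fin.cast h (Fin.natAdd r i))) := rfl

/-- Wedge product of alternating forms; `n` is the total degree:
`(α ∧ β)(v) = 1/(r! s!) ∑_σ sgn(σ) α(v_{σ(1)}, …, v_{σ(r)}) β(v_{σ(r+1)}, …, v_{σ(r+s)})`. -/
def wedgeAlt {r s n : ℕ} (h : r + s = n) (α : Alt r) (β : Alt s) : Alt n :=
  ((r.factorial * s.factorial : ℝ)⁻¹) •
    ContinuousMultilinearMap.alternatization (tensorAlt h α β)

lemma wedgeAlt_apply {r s n : ℕ} (h : r + s = n) (α : Alt r) (β : Alt s) (v : Fin n → V) :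
    wedgeAlt h α β v = ((r.factorial * s.factorial : ℝ)⁻¹) *
      ∑ σ : Equiv.Perm (Fin n), ((Equiv.Perm.sign σ : ℤ) : ℝ) *
        (α (fun i => v (σ (Fin.cast h (Fin.castAdd s i)))) *
          β (fun i => v (σ (Fin.cast h (Fin.natAdd r i))))) := by
  simp only [wedgeAlt, ContinuousAlternatingMap.smul_apply,
    ContinuousMultilinearMap.alternatization_apply_apply, tensorAlt_apply, smul_eq_mul,
    Function.comp_apply]
  congr 1
  refine Finset.sum_congr rfl fun σ _ => ?_
  rw [Units.smul_def, zsmul_eq_mul]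

instance (k : ℕ) : FiniteDimensional ℝ (Alt k) :=
  FiniteDimensional.of_injective
    ({ toFun := fun f => f.toMultilinearMap
       map_add' := fun _ _ => rfl
       map_smul' := fun _ _ => rfl } :
      Alt k →ₗ[ℝ] MultilinearMap ℝ (fun _ : Fin k => V) ℝ)
    (fun f g h => by
      ext v
      exact congrArg (fun m : MultilinearMap ℝ (fun _ : Fin k => V) ℝ => m v) h)

lemma isBilinearMap_wedgeAlt {r s n : ℕ} (h : r + s = n) :
    IsBilinearMap ℝ (fun (α : Alt r) (β : Alt s) => wedgeAlt h α β) where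
  add_left a a' b := by
    ext v
    simp only [wedgeAlt_apply, ContinuousAlternatingMap.add_apply, add_mul, mul_add,
      Finset.sum_add_distrib]
  smul_left c a b := by
    ext v
    simp only [wedgeAlt_apply, ContinuousAlternatingMap.smul_apply, smul_eq_mul, Finset.mul_sum]
    exact Finset.sum_congr rfl fun σ _ => by ring
  add_right a b b' := by
    ext v
    simp only [wedgeAlt_apply, ContinuousAlternatingMap.add_apply, mul_add,
      Finset.sum_add_distrib]
  smul_right c a b := by
    ext v
    simp only [wedgeAlt_apply, ContinuousAlternatingMap.smul_apply, smul_eq_mul, Finset.mul_sum]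
    exact Finset.sum_congr rfl fun σ _ => by ring

/-- Wedge product of differential forms; `n` is the total degree. -/
def wedge {r s n : ℕ} (h : r + s = n) (α : Form r) (β : Form s) : Form n :=
  ⟨fun q => wedgeAlt h (α.1 q) (β.1 q), by
    change ContDiff ℝ ∞ (fun x =>
      (isBilinearMap_wedgeAlt h).toContinuousBilinearMap (α.1 (proj x)) (β.1 (proj x)))
    exact ((isBilinearMap_wedgeAlt h).toContinuousBilinearMap.contDiff.comp
      (Form.smooth α)).clm_apply (Form.smooth β)⟩

/-! ### Contraction with, and Lie derivative along, a bivector field -/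

/-- Contraction with a constant vector field: `(ι_v om)(v₁, …, v_k) = om(v, v₁, …, v_k)`. -/
def contrVec {k : ℕ} (v : V) (om : Form (k + 1)) : Form k :=
  ⟨fun q => (om.1 q).curryLeft v,
    ((ContinuousLinearMap.apply ℝ (Alt k) v).comp
      (ContinuousAlternatingMap.curryLeftLI (𝕜 := ℝ) (E := V) (F := ℝ)
        (n := k)).toContinuousLinearMap).contDiff.comp om.smooth⟩

/-- Multiplication of a form by a smooth function. -/
def fmul {k : ℕ} (f : smoothFun) (om : Form k) : Form k :=
  ⟨fun q => f.1 q • om.1 q, smul_smooth f.2 om.2⟩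

/-- The derivative `∂f/∂θ_l`. -/
def pderiv (l : Fin 4) (f : smoothFun) : smoothFun :=
  ⟨fun q => fderiv ℝ (fun x => f.1 (proj x)) (lift q) (e l), by
    change ContDiff ℝ ∞ _
    simp only [fderiv_proj]
    have hf : ContDiff ℝ ∞ (fun x => f.1 (proj x)) := f.2
    exact (hf.fderiv_right (m := ∞) (by simp)).clm_apply contDiff_const⟩

/-- A smooth bivector field `Z = ∑_{i<j} Z^{ij} ∂ᵢ ∧ ∂ⱼ` on `T⁴`, given by its components in the
global frame `∂/∂θ₁, …, ∂/∂θ₄`. -/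
structure Bivector where
  comp : Fin 4 → Fin 4 → smoothFun
  antisymm : ∀ i j, comp i j = -comp j i

/-- `Z♯ : T*M → TM`, `ξ ↦ Z(ξ, ·)`. -/
def Bivector.sharp (Z : Bivector) (q : T4) : (V →L[ℝ] ℝ) →ₗ[ℝ] V where
  toFun ξ := ∑ i, ∑ j, ((Z.comp i j).1 q * ξ (e i)) • e j
  map_add' ξ ξ' := by
    simp only [add_apply, mul_add, add_smul, Finset.sum_add_distrib]
  map_smul' c ξ := by
    simp only [smul_apply, smul_eq_mul, Finset.smul_sum, smul_smul,
      RingHom.id_apply]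
    exact Finset.sum_congr rfl fun i _ => Finset.sum_congr rfl fun j _ => by ring_nf

/-- Contraction `ι_Z : Ω^{k+2} → Ω^k`, with the convention `ι_{X ∧ Y} = ι_X ∘ ι_Y`; for
`Z = ½ ∑ Z^{ij} ∂ᵢ ∧ ∂ⱼ` it is `½ ∑ Z^{ij} ι_{∂ᵢ} ι_{∂ⱼ}`. -/
def contr {k : ℕ} (Z : Bivector) (om : Form (k + 2)) : Form k :=
  (2⁻¹ : ℝ) • ∑ i, ∑ j, fmul (Z.comp i j) (contrVec (e i) (contrVec (e j) om))

/-- The Lie derivative `L_Z = ι_Z ∘ d - d ∘ ι_Z : Ω^{k+1} → Ω^k` (`ι_Z = 0` on 1-forms). -/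
def lieD (Z : Bivector) : {k : ℕ} → Form (k + 1) → Form k
  | 0, om => contr Z (d om)
  | _ + 1, om => contr Z (d om) - d (contr Z om)

/-! ### The Koszul brackets -/

/-- The Koszul bracket of forms of positive degree,
`[α,β]_Z = (-1)^{|α|+1} (L_Z(α ∧ β) - L_Z(α) ∧ β - (-1)^{|α|} α ∧ L_Z(β))`. -/
def koszul (Z : Bivector) {r s : ℕ} (α : Form (r + 1)) (β : Form (s + 1)) : Form (r + s + 1) :=
  (-1 : ℝ) ^ (r + 1 + 1) •
    (lieD Z (wedge (n := r + s + 1 + 1) (by omega) α β)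
      - wedge (by omega) (lieD Z α) β
      - (-1 : ℝ) ^ (r + 1) • wedge (by omega) α (lieD Z β))

/-- Components of `½[Z,Z]` (Schouten–Nijenhuis bracket, `[L_Y, ι_{Y'}] = ι_{[Y,Y']}`) in the frame
`∂/∂θᵢ`: `∑_l (Z^{kl} ∂_l Z^{ij} + Z^{il} ∂_l Z^{jk} + Z^{jl} ∂_l Z^{ki})`. -/
def Bivector.halfSchouten (Z : Bivector) (i j k : Fin 4) : smoothFun :=
  ∑ l, (Z.comp k l * pderiv l (Z.comp i j) + Z.comp i l * pderiv l (Z.comp j k)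
    + Z.comp j l * pderiv l (Z.comp k i))

/-- `(α♯ ∧ β♯ ∧ γ♯)(v₁ ∧ v₂ ∧ v₃) = ∑_σ sgn(σ) ι_{v_{σ(1)}}α ∧ ι_{v_{σ(2)}}β ∧ ι_{v_{σ(3)}}γ`. -/
def sharpWedge {r s t : ℕ} (α : Form (r + 1)) (β : Form (s + 1)) (γ : Form (t + 1))
    (v : Fin 3 → V) : Form (r + s + t) :=
  ∑ σ : Equiv.Perm (Fin 3), ((Equiv.Perm.sign σ : ℤ) : ℝ) •
    wedge rfl (wedge rfl (contrVec (v (σ 0)) α) (contrVec (v (σ 1)) β)) (contrVec (v (σ 2)) γ)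

/-- The trinary bracket `[α,β,γ]_Z = (α♯ ∧ β♯ ∧ γ♯)(½[Z,Z])`; a trivector field with components
`T^{ijk}` is `(1/6) ∑ T^{ijk} ∂ᵢ ∧ ∂ⱼ ∧ ∂ₖ`. -/
def koszul3 (Z : Bivector) {r s t : ℕ} (α : Form (r + 1)) (β : Form (s + 1))
    (γ : Form (t + 1)) : Form (r + s + t) :=
  (6⁻¹ : ℝ) • ∑ i, ∑ j, ∑ k,
    fmul (Z.halfSchouten i j k) (sharpWedge α β γ ![e i, e j, e k])

/-- `λ₂(α[2] ⊙ β[2]) = (-1)^{|α|} [α,β]_Z [2]`. -/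
def lam2 (Z : Bivector) {r s : ℕ} (α : Form (r + 1)) (β : Form (s + 1)) : Form (r + s + 1) :=
  (-1 : ℝ) ^ (r + 1) • koszul Z α β

/-- `λ₃(α[2] ⊙ β[2] ⊙ γ[2]) = (-1)^{|β|+1} (α♯ ∧ β♯ ∧ γ♯)(½[Z,Z]) [2]`. -/
def lam3 (Z : Bivector) {r s t : ℕ} (α : Form (r + 1)) (β : Form (s + 1))
    (γ : Form (t + 1)) : Form (r + s + t) :=
  (-1 : ℝ) ^ (s + 1 + 1) • koszul3 Z α β γ

/-! ### Pre-symplectic forms and horizontal forms -/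

/-- The bundle map `η♯ : TM → T*M`, `v ↦ η(v, ·)`, at the point `q`. -/
def flat (η : Form 2) (q : T4) : V →ₗ[ℝ] (V →L[ℝ] ℝ) where
  toFun v := (ContinuousAlternatingMap.ofSubsingleton ℝ V ℝ (0 : Fin 1)).symm
    ((η.1 q).curryLeft v)
  map_add' v v' := by
    rw [map_add]
    rfl
  map_smul' c v := by
    rw [map_smul]
    rfl

lemma flat_apply (η : Form 2) (q : T4) (v w : V) : flat η q v w = η.1 q ![v, w] := by
  change η.1 q (Matrix.vecCons v fun _ => w) = _
  congr 1
  funext i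
  fin_cases i <;> rfl

/-- The kernel `K = ker η♯` at the point `q`. -/
def kerAt (η : Form 2) (q : T4) : Submodule ℝ V := LinearMap.ker (flat η q)

/-- `η` is a pre-symplectic form of rank `k`: closed, with `η♯` of constant rank `k`. -/
def IsPreSymplectic (k : ℕ) (η : Form 2) : Prop :=
  d η = 0 ∧ ∀ q, Module.finrank ℝ (LinearMap.range (flat η q)) = k

/-- `G` is a complement to the kernel of `η`, and `Z ∈ Γ(∧²G)` is the bivector field determined by
`Z♯ = -(η♯|_G)⁻¹`. -/
def IsNegInverse (η : Form 2) (G : T4 → Submodule ℝ V) (Z : Bivector) : Prop :=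
  ∀ q, IsCompl (kerAt η q) (G q) ∧ LinearMap.range (Z.sharp q) ≤ G q ∧
    ∀ v ∈ G q, Z.sharp q (flat η q v) = -v

/-- `Ω^k_hor(M)`: the `k`-forms whose restriction to `K = ker η♯` vanishes. -/
def horForm (η : Form 2) (k : ℕ) : Submodule ℝ (Form k) where
  carrier := {om | ∀ q (v : Fin k → V), (∀ i, v i ∈ kerAt η q) → om.1 q v = 0}
  zero_mem' := fun _ _ _ => rfl
  add_mem' {a b} ha hb := fun q v hv => by
    change a.1 q v + b.1 q v = 0
    rw [ha q v hv, hb q v hv, add_zero]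
  smul_mem' c a ha := fun q v hv => by
    change c * a.1 q v = 0
    rw [ha q v hv, mul_zero]

/-- The closed horizontal `k`-forms. -/
def closedHor (η : Form 2) (k : ℕ) : Submodule ℝ (Form k) := horForm η k ⊓ LinearMap.ker d

/-- The `(k+1)`-forms that are differentials of horizontal `k`-forms. -/
def exactHor (η : Form 2) (k : ℕ) : Submodule ℝ (Form (k + 1)) := (horForm η k).map d

/-- The cohomology of `(Ω_hor(M), d)` in form degree `k + 1`. In the grading of the Koszul
`L_∞[1]`-algebra `Ω_hor(M)[2]`, form degree `2` is degree `0` and form degree `3` is degree `1`. -/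
abbrev HHor (η : Form 2) (k : ℕ) : Type :=
  closedHor η (k + 1) ⧸ (exactHor η k).submoduleOf (closedHor η (k + 1))

/-- The class of a closed horizontal form. -/
def cls {η : Form 2} {k : ℕ} (w : closedHor η (k + 1)) : HHor η k := Submodule.Quotient.mk w

/-! ### Maurer–Cartan elements and obstructions -/

/-- Maurer–Cartan elements of the Koszul `L_∞[1]`-algebra `Ω_hor(M)[2]`. -/
def IsMC (η : Form 2) (Z : Bivector) (β : Form 2) : Prop :=
  β ∈ horForm η 2 ∧
    d β + (2⁻¹ : ℝ) • lam2 Z β β + (6⁻¹ : ℝ) • lam3 Z β β β = 0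

/-- `∑ wₙ tⁿ` is a formal curve of Maurer–Cartan elements of `Ω_hor(M)[2]` starting at `0`: the
Maurer–Cartan equation holds coefficientwise in powers of `t`. -/
def IsFormalMCCurve (η : Form 2) (Z : Bivector) (w : ℕ → Form 2) : Prop :=
  w 0 = 0 ∧ (∀ n, w n ∈ horForm η 2) ∧
    ∀ n, d (w n)
      + (2⁻¹ : ℝ) • ∑ p ∈ Finset.HasAntidiagonal.antidiagonal n, lam2 Z (w p.1) (w p.2)
      + (6⁻¹ : ℝ) • ∑ p ∈ Finset.HasAntidiagonal.antidiagonal n, ∑ p' ∈ Finset.HasAntidiagonal.antidiagonal p.2,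
          lam3 Z (w p.1) (w p'.1) (w p'.2) = 0

/-- `(βₜ)` is, for `t ∈ [0, ε)`, a smooth one-parameter family of 2-forms (smooth in `(t, θ)`)
with `d/dt|₀ βₜ = w`. -/
def IsSmoothFamily (ε : ℝ) (β : ℝ → Form 2) (w : Form 2) : Prop :=
  ContDiffOn ℝ ∞ (fun p : ℝ × V => (β p.1).1 (proj p.2)) (Set.Ico 0 ε ×ˢ Set.univ) ∧
    ∀ q, HasDerivWithinAt (fun t => (β t).1 q) (w.1 q) (Set.Ici 0) 0

/-- `w` extends to a formal curve of Maurer–Cartan elements. -/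
def ExtendsFormally (η : Form 2) (Z : Bivector) (w : Form 2) : Prop :=
  ∃ u : ℕ → Form 2, IsFormalMCCurve η Z u ∧ u 1 = w

/-- `w` extends to a smooth curve of Maurer–Cartan elements. -/
def ExtendsSmoothly (η : Form 2) (Z : Bivector) (w : Form 2) : Prop :=
  ∃ ε > 0, ∃ β : ℝ → Form 2, IsSmoothFamily ε β w ∧ β 0 = 0 ∧
    ∀ t ∈ Set.Ico 0 ε, IsMC η Z (β t)

/-- `w` is the velocity of a smooth family of pre-symplectic forms of rank `k` starting at `η`. -/
def IsPreSymplecticVelocity (k : ℕ) (η w : Form 2) : Prop :=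
  ∃ ε > 0, ∃ ζ : ℝ → Form 2, IsSmoothFamily ε ζ w ∧ ζ 0 = η ∧
    ∀ t ∈ Set.Ico 0 ε, IsPreSymplectic k (ζ t)

/-! ### The example -/

/-- `dθᵢ` at a point. -/
def dθ (i : Fin 4) : Alt 1 :=
  ContinuousAlternatingMap.ofSubsingleton ℝ V ℝ (0 : Fin 1) (ContinuousLinearMap.proj i)

/-- `dθᵢ ∧ dθⱼ` at a point. -/
def dθ2 (i j : Fin 4) : Alt 2 := wedgeAlt rfl (dθ i) (dθ j)

/-- `dθᵢ ∧ dθⱼ ∧ dθₖ` at a point. -/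
def dθ3 (i j k : Fin 4) : Alt 3 := wedgeAlt rfl (dθ2 i j) (dθ k)

/-- `η = dθ₃ ∧ dθ₄`. -/
def eta : Form 2 := ⟨fun _ => dθ2 2 3, const_smooth _⟩

/-- The span `G` of `∂/∂θ₃` and `∂/∂θ₄`. -/
def G34 : T4 → Submodule ℝ V := fun _ => Submodule.span ℝ {e 2, e 3}

/-- `π = ∂/∂θ₃ ∧ ∂/∂θ₄`. -/
def biv : Bivector where
  comp i j := algebraMap ℝ smoothFun
    ((if i = 2 ∧ j = 3 then 1 else 0) - (if i = 3 ∧ j = 2 then 1 else 0))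
  antisymm i j := by
    rw [← map_neg]
    congr 1
    simp only [and_comm, neg_sub]

/-- Smooth functions on the circle. -/
def IsSmoothS1 (f : S1 → ℝ) : Prop := ContDiff ℝ ∞ (fun t : ℝ => f t)

lemma comp_coord_smooth {f : S1 → ℝ} (hf : IsSmoothS1 f) (i : Fin 4) :
    (fun q : T4 => f (q i)) ∈ smoothFun :=
  ContDiff.comp (g := fun t : ℝ => f t) hf (contDiff_apply ℝ ℝ i)

/-- `B = f(θ₃) dθ₁ ∧ dθ₃ + g(θ₄) dθ₂ ∧ dθ₄`. -/
def formB (f g : S1 → ℝ) (hf : IsSmoothS1 f) (hg : IsSmoothS1 g) : Form 2 :=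
  ⟨fun q => f (q 2) • dθ2 0 2 + g (q 3) • dθ2 1 3,
    (formSpace 2).add_mem
      (smul_smooth (comp_coord_smooth hf 2) (const_smooth _))
      (smul_smooth (comp_coord_smooth hg 3) (const_smooth _))⟩

/-- The cosine on `S¹ = ℝ / 2πℤ`. -/
def cosS1 : S1 → ℝ := Real.cos_periodic.lift

lemma cosS1_smooth : IsSmoothS1 cosS1 := Real.contDiff_cos

end KoszulTorus

end

open KoszulTorus

/-! Let `w` be a closed horizontal 2-form and `T(w) = ι_{∂₃}w ∧ ι_{∂₄}w`. Then
`λ₂(w, w) = 2 d T(w)`, and changing `w` by the differential of a horizontal form changes `T(w)` by a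
horizontal form and an exact one. So the integral of `T(w)` over the leaf of `K` at `(θ₃, θ₄)` is an
invariant of the class of `w`; for `w = B` it equals `(2π)² f(θ₃) g(θ₄)`. It does not depend on `θ₃`
when `w` is unobstructed:
* if `Kr([w]) = 0`, subtracting a horizontal primitive of `λ₂(w, w)` from `2 T(w)` gives a closed
  form with the same leaf integrals, and Stokes' theorem applies;
* if `βₜ` is a curve of Maurer–Cartan elements with velocity `w`, then the gauge transform
  `βₜ + (1 - βₜ(∂₃, ∂₄))⁻¹ T(βₜ)` is closed, and its leaf integral is `t² ∫ T(w) + o(t²)`;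
* if `ζₜ` is a curve of pre-symplectic forms of rank 2 with velocity `w`, then `ζₜ ∧ ζₜ = 0` reads
  `ζₜ(∂₁, ∂₂) = ζₜ(∂₃, ∂₄)⁻¹ T(ζₜ)(∂₁, ∂₂)`, which leads to the same limit. -/

noncomputable section

namespace KoszulTorus

open Equiv Matrix

/-! ### Wedge products in low degree -/

/-- The antisymmetrization `∑_σ sgn(σ) F(v_{σ(1)}, …, v_{σ(n)})`; it obeys a recursion in `n` that
evaluates wedge products of forms of low degree. -/
def antisymmSum {X : Type*} {n : ℕ} (F : (Fin n → X) → ℝ) (v : Fin n → X) : ℝ :=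
  ∑ σ : Perm (Fin n), ((Perm.sign σ : ℤ) : ℝ) * F (v ∘ σ)

@[simp]
lemma antisymmSum_zero {X : Type*} (F : (Fin 0 → X) → ℝ) (v : Fin 0 → X) :
    antisymmSum F v = F v := by
  simp [antisymmSum]

lemma vecCons_comp_decomposeFin_symm_zero {X : Type*} {n : ℕ} (a : X) (v : Fin n → X)
    (σ : Perm (Fin n)) :
    vecCons a v ∘ Perm.decomposeFin.symm (0, σ) = vecCons a (v ∘ σ) := by
  ext i : 1
  cases i using Fin.cases <;> simp

lemma vecCons_comp_decomposeFin_symm_succ {X : Type*} {n : ℕ} (a : X) (v : Fin n → X)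
    (p : Fin n) (σ : Perm (Fin n)) :
    vecCons a v ∘ Perm.decomposeFin.symm (p.succ, σ)
      = vecCons (v p) (Function.update v p a ∘ σ) := by
  ext i : 1
  cases i using Fin.cases with
  | zero => simp
  | succ i =>
    by_cases h : σ i = p
    · simp [h]
    · simp [h, swap_apply_of_ne_of_ne, Fin.succ_ne_zero]

@[simp]
lemma antisymmSum_vecCons {X : Type*} {n : ℕ} (F : (Fin (n + 1) → X) → ℝ) (a : X)
    (v : Fin n → X) :
    antisymmSum F (vecCons a v) = antisymmSum (fun w => F (vecCons a w)) v
      - ∑ p, antisymmSum (fun w => F (vecCons (v p) w)) (Function.update v p a) := by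
  simp only [antisymmSum]
  rw [← Equiv.sum_comp Perm.decomposeFin.symm, Fintype.sum_prod_type, Fin.sum_univ_succ,
    sub_eq_add_neg, ← Finset.sum_neg_distrib]
  simp [vecCons_comp_decomposeFin_symm_zero, vecCons_comp_decomposeFin_symm_succ,
    Perm.decomposeFin.symm_sign, Fin.succ_ne_zero]

@[simp]
lemma update_vecCons_zero {X : Type*} {n : ℕ} (a b : X) (v : Fin n → X) :
    Function.update (vecCons a v) 0 b = vecCons b v := Fin.update_cons_zero ..

@[simp]
lemma update_vecCons_succ {X : Type*} {n : ℕ} (a b : X) (v : Fin n → X) (i : Fin n) :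
    Function.update (vecCons a v) i.succ b = vecCons a (Function.update v i b) :=
  (Fin.cons_update ..).symm

@[simp]
lemma update_vecCons_one {X : Type*} {n : ℕ} (a b : X) (v : Fin (n + 1) → X) :
    Function.update (vecCons a v) 1 b = vecCons a (Function.update v 0 b) :=
  update_vecCons_succ a b v 0

lemma alt_vecCons_swap {k : ℕ} (a : Alt (k + 2)) (u v : V) (w : Fin k → V) :
    a (vecCons u (vecCons v w)) = -a (vecCons v (vecCons u w)) := by
  have h01 : (0 : Fin (k + 2)) ≠ 1 := by simp
  simpa using a.toAlternatingMap.map_swap (vecCons v (vecCons u w)) h01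

lemma wedgeAlt_eq_antisymmSum {r s n : ℕ} (h : r + s = n) (α : Alt r) (β : Alt s)
    (v : Fin n → V) :
    wedgeAlt h α β v = (r.factorial * s.factorial : ℝ)⁻¹ *
      antisymmSum (fun w => α (FinVec.etaExpand fun i => w (Fin.cast h (Fin.castAdd s i))) *
        β (FinVec.etaExpand fun i => w (Fin.cast h (Fin.natAdd r i)))) v := by
  simp only [FinVec.etaExpand_eq]
  exact wedgeAlt_apply h α β v

lemma wedgeAlt_one_one (h : 1 + 1 = 2) (α β : Alt 1) (u v : V) :
    wedgeAlt h α β ![u, v] = α ![u] * β ![v] - α ![v] * β ![u] := by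
  rw [wedgeAlt_eq_antisymmSum]
  change _ * antisymmSum (fun x => α ![x 0] * β ![x 1]) _ = _
  simp

lemma wedgeAlt_one_two (h : 1 + 2 = 3) (α : Alt 1) (β : Alt 2) (u v w : V) :
    wedgeAlt h α β ![u, v, w]
      = α ![u] * β ![v, w] - α ![v] * β ![u, w] + α ![w] * β ![u, v] := by
  have swap := alt_vecCons_swap β (w := ![])
  rw [wedgeAlt_eq_antisymmSum]
  change _ * antisymmSum (fun x => α ![x 0] * β ![x 1, x 2]) _ = _
  simp [Fin.sum_univ_succ, swap v u, swap w u, swap w v]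
  ring

lemma wedgeAlt_two_one (h : 2 + 1 = 3) (α : Alt 2) (β : Alt 1) (u v w : V) :
    wedgeAlt h α β ![u, v, w]
      = β ![u] * α ![v, w] - β ![v] * α ![u, w] + β ![w] * α ![u, v] := by
  have swap := alt_vecCons_swap α (w := ![])
  rw [wedgeAlt_eq_antisymmSum]
  change _ * antisymmSum (fun x => α ![x 0, x 1] * β ![x 2]) _ = _
  simp [Fin.sum_univ_succ, swap v u, swap w u, swap w v]
  ring

lemma wedgeAlt_two_two (h : 2 + 2 = 4) (α β : Alt 2) (u v w x : V) :
    wedgeAlt h α β ![u, v, w, x]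
      = α ![u, v] * β ![w, x] - α ![u, w] * β ![v, x] + α ![u, x] * β ![v, w]
        + α ![v, w] * β ![u, x] - α ![v, x] * β ![u, w] + α ![w, x] * β ![u, v] := by
  have swap (a : Alt 2) := alt_vecCons_swap a (w := ![])
  rw [wedgeAlt_eq_antisymmSum]
  change _ * antisymmSum (fun y => α ![y 0, y 1] * β ![y 2, y 3]) _ = _
  simp [Fin.sum_univ_succ, Nat.factorial, swap _ v u, swap _ w u, swap _ x u, swap _ w v,
    swap _ x v, swap _ x w]
  ring

/-! ### Coefficients of differential forms -/

lemma eval_smooth {k : ℕ} (om : Form k) (v : Fin k → V) : (fun q => om.1 q v) ∈ smoothFun := by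
  change ContDiff ℝ ∞ (fun x => om.1 (proj x) v)
  exact (ContinuousAlternatingMap.apply ℝ V ℝ v).contDiff.comp om.smooth

/-- The function `om(v₁, …, v_k)` for constant vector fields `vᵢ`. -/
def Form.eval {k : ℕ} (v : Fin k → V) : Form k →ₗ[ℝ] smoothFun where
  toFun om := ⟨fun q => om.1 q v, eval_smooth om v⟩
  map_add' _ _ := rfl
  map_smul' _ _ := rfl

/-- The coefficient `om(∂ᵢ)`. -/
abbrev coeff1 (om : Form 1) (i : Fin 4) : smoothFun := Form.eval ![e i] om

/-- The coefficient `om(∂ᵢ, ∂ⱼ)`. -/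
abbrev coeff2 (om : Form 2) (i j : Fin 4) : smoothFun := Form.eval ![e i, e j] om

/-- The coefficient `om(∂ᵢ, ∂ⱼ, ∂ₖ)`. -/
abbrev coeff3 (om : Form 3) (i j k : Fin 4) : smoothFun := Form.eval ![e i, e j, e k] om

lemma Form.eval_apply {k : ℕ} (v : Fin k → V) (om : Form k) (q : T4) :
    (Form.eval v om).1 q = om.1 q v := rfl

lemma Form.eval_vecCons_swap {k : ℕ} (om : Form (k + 2)) (u v : V) (w : Fin k → V) :
    Form.eval (vecCons u (vecCons v w)) om = -Form.eval (vecCons v (vecCons u w)) om :=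
  Subtype.ext (funext fun q => alt_vecCons_swap (om.1 q) u v w)

lemma coeff2_self (om : Form 2) (i : Fin 4) : coeff2 om i i = 0 :=
  Subtype.ext (funext fun q =>
    (om.1 q).map_eq_zero_of_eq ![e i, e i] (i := 0) (j := 1) rfl (by decide))

lemma alt_ext {k : ℕ} {a b : Alt k} (h : ∀ I : Fin k → Fin 4, a (e ∘ I) = b (e ∘ I)) : a = b := by
  apply ContinuousAlternatingMap.toAlternatingMap_injective
  refine Module.Basis.ext_alternating (Pi.basisFun ℝ (Fin 4)) fun I _ => ?_
  simpa [e, Function.comp_def] using h I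

lemma comp_eq_vec_three {X Y : Type*} (f : X → Y) (I : Fin 3 → X) :
    f ∘ I = ![f (I 0), f (I 1), f (I 2)] :=
  (FinVec.etaExpand_eq _).symm

lemma alt_three_ext {a b : Alt 3}
    (h : ∀ i j k, a ![e i, e j, e k] = b ![e i, e j, e k]) : a = b :=
  alt_ext fun I => by simpa only [comp_eq_vec_three] using h (I 0) (I 1) (I 2)

lemma Form.ext_coeff3 {a b : Form 3} (h : ∀ i j k, coeff3 a i j k = coeff3 b i j k) : a = b :=
  Subtype.ext (funext fun q => alt_three_ext fun i j k =>
    congrFun (congrArg Subtype.val (h i j k)) q)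

lemma form_eq_zero_of_lt {k : ℕ} (hk : 4 < k) (om : Form k) : om = 0 := by
  refine Subtype.ext (funext fun q => ?_)
  ext v
  refine (om.1 q).toAlternatingMap.map_linearDependent v fun h => ?_
  have hcard := h.fintype_card_le_finrank
  rw [Fintype.card_fin, Module.finrank_fin_fun] at hcard
  omega

/-! ### Partial derivatives -/

lemma smoothFun_ext {f g : smoothFun} (h : ∀ x : V, f.1 (proj x) = g.1 (proj x)) : f = g :=
  Subtype.ext (proj_surjective.injective_comp_right (funext h))

lemma smoothFun_differentiableAt (f : smoothFun) (x : V) :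
    DifferentiableAt ℝ (fun z => f.1 (proj z)) x :=
  (ContDiff.differentiable (n := ∞) f.2 (by simp)).differentiableAt

lemma pderiv_apply_proj (l : Fin 4) (f : smoothFun) (x : V) :
    (pderiv l f).1 (proj x) = fderiv ℝ (fun z => f.1 (proj z)) x (e l) :=
  DFunLike.congr_fun (fderiv_proj f.1 x) (e l)

/-- `∂/∂θ_l` as a derivation of `C^∞(T⁴)`. -/
def pder (l : Fin 4) : Derivation ℝ smoothFun smoothFun :=
  Derivation.mk'
    { toFun := pderiv l
      map_add' := fun f g => smoothFun_ext fun x => by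
        simp only [Subalgebra.coe_add, Pi.add_apply, pderiv_apply_proj]
        exact DFunLike.congr_fun
          (fderiv_add (smoothFun_differentiableAt f x) (smoothFun_differentiableAt g x)) (e l)
      map_smul' := fun c f => smoothFun_ext fun x => by
        simp only [Subalgebra.coe_smul, Pi.smul_apply, pderiv_apply_proj, RingHom.id_apply]
        exact DFunLike.congr_fun (fderiv_const_smul (smoothFun_differentiableAt f x) c) (e l) }
    fun f g => smoothFun_ext fun x => by
      simp only [LinearMap.coe_mk, AddHom.coe_mk, smul_eq_mul, Subalgebra.coe_add,
        Subalgebra.coe_mul, Pi.add_apply, Pi.mul_apply, pderiv_apply_proj]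
      exact DFunLike.congr_fun
        (fderiv_mul (smoothFun_differentiableAt f x) (smoothFun_differentiableAt g x)) (e l)

lemma pder_apply_proj (l : Fin 4) (f : smoothFun) (x : V) :
    (pder l f).1 (proj x) = fderiv ℝ (fun z => f.1 (proj z)) x (e l) :=
  pderiv_apply_proj l f x

/-! ### Coefficients of the operations on forms -/

lemma Form.eval_d {k : ℕ} (om : Form k) (I : Fin (k + 1) → Fin 4) :
    Form.eval (e ∘ I) (d om)
      = ∑ p : Fin (k + 1),
          (-1 : ℝ) ^ (p : ℕ) • pder (I p) (Form.eval (e ∘ I ∘ p.succAbove) om) := by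
  refine smoothFun_ext fun x => ?_
  rw [Form.eval_apply, d_apply_proj,
    extDeriv_apply (om.smooth.differentiable (by simp)).differentiableAt]
  simp only [AddSubmonoidClass.coe_finsetSum, Finset.sum_apply, Subalgebra.coe_smul,
    Pi.smul_apply, pder_apply_proj]
  refine Finset.sum_congr rfl fun p _ => ?_
  rw [← Int.cast_smul_eq_zsmul ℝ]
  norm_cast

lemma comp_vecCons {X Y : Type*} {n : ℕ} (f : X → Y) (a : X) (v : Fin n → X) :
    f ∘ vecCons a v = vecCons (f a) (f ∘ v) := Fin.comp_cons ..

lemma vecCons_comp_zero_succAbove {X : Type*} {n : ℕ} (a : X) (v : Fin n → X) :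
    vecCons a v ∘ Fin.succAbove 0 = v := rfl

lemma vecCons_comp_succ_succAbove {X : Type*} {n : ℕ} (a : X) (v : Fin (n + 1) → X)
    (p : Fin (n + 1)) : vecCons a v ∘ p.succ.succAbove = vecCons a (v ∘ p.succAbove) :=
  Fin.cons_comp_succ_succAbove ..

lemma comp_vecEmpty {X Y : Type*} (f : X → Y) (v : Fin 0 → X) : f ∘ v = ![] :=
  Subsingleton.elim _ _

lemma coeff1_d (om : Form 0) (i : Fin 4) : coeff1 (d om) i = pder i (Form.eval ![] om) := by
  have h := Form.eval_d om ![i]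
  simpa [comp_vecCons, comp_vecEmpty] using h

lemma coeff2_d (om : Form 1) (i j : Fin 4) :
    coeff2 (d om) i j = pder i (coeff1 om j) - pder j (coeff1 om i) := by
  have h := Form.eval_d om ![i, j]
  simpa [comp_vecCons, comp_vecEmpty, vecCons_comp_zero_succAbove, vecCons_comp_succ_succAbove,
    Fin.sum_univ_succ, sub_eq_add_neg, -Fin.succAbove_zero] using h

lemma coeff3_d (om : Form 2) (i j k : Fin 4) :
    coeff3 (d om) i j k
      = pder i (coeff2 om j k) - pder j (coeff2 om i k) + pder k (coeff2 om i j) := by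
  have h := Form.eval_d om ![i, j, k]
  simpa [comp_vecCons, comp_vecEmpty, vecCons_comp_zero_succAbove, vecCons_comp_succ_succAbove,
    Fin.sum_univ_succ, sub_eq_add_neg, -Fin.succAbove_zero, ← add_assoc] using h

lemma coeff2_swap (om : Form 2) (i j : Fin 4) : coeff2 om i j = -coeff2 om j i :=
  Form.eval_vecCons_swap om (e i) (e j) ![]

lemma coeff2_wedge (h : 1 + 1 = 2) (α β : Form 1) (i j : Fin 4) :
    coeff2 (wedge h α β) i j = coeff1 α i * coeff1 β j - coeff1 α j * coeff1 β i :=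
  Subtype.ext (funext fun q => wedgeAlt_one_one h (α.1 q) (β.1 q) (e i) (e j))

lemma coeff3_wedge_one_two (h : 1 + 2 = 3) (α : Form 1) (β : Form 2) (i j k : Fin 4) :
    coeff3 (wedge h α β) i j k
      = coeff1 α i * coeff2 β j k - coeff1 α j * coeff2 β i k + coeff1 α k * coeff2 β i j :=
  Subtype.ext (funext fun q => wedgeAlt_one_two h (α.1 q) (β.1 q) (e i) (e j) (e k))

lemma coeff3_wedge_two_one (h : 2 + 1 = 3) (α : Form 2) (β : Form 1) (i j k : Fin 4) :
    coeff3 (wedge h α β) i j k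
      = coeff1 β i * coeff2 α j k - coeff1 β j * coeff2 α i k + coeff1 β k * coeff2 α i j :=
  Subtype.ext (funext fun q => wedgeAlt_two_one h (α.1 q) (β.1 q) (e i) (e j) (e k))

lemma eval_wedge_two_two (h : 2 + 2 = 4) (α β : Form 2) (i j k l : Fin 4) :
    Form.eval ![e i, e j, e k, e l] (wedge h α β)
      = coeff2 α i j * coeff2 β k l - coeff2 α i k * coeff2 β j l + coeff2 α i l * coeff2 β j k
        + coeff2 α j k * coeff2 β i l - coeff2 α j l * coeff2 β i k
        + coeff2 α k l * coeff2 β i j :=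
  Subtype.ext (funext fun q => wedgeAlt_two_two h (α.1 q) (β.1 q) (e i) (e j) (e k) (e l))

lemma closed_coeff {w : Form 2} (hw : d w = 0) (i j k : Fin 4) :
    pder i (coeff2 w j k) - pder j (coeff2 w i k) + pder k (coeff2 w i j) = 0 := by
  rw [← coeff3_d, hw]
  exact map_zero _

/-! ### The Koszul brackets of `π = ∂₃ ∧ ∂₄` -/

lemma fmul_algebraMap {k : ℕ} (c : ℝ) (om : Form k) : fmul (algebraMap ℝ smoothFun c) om = c • om :=
  rfl

lemma contrVec_swap {k : ℕ} (u v : V) (om : Form (k + 2)) :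
    contrVec u (contrVec v om) = -contrVec v (contrVec u om) := by
  refine Subtype.ext (funext fun q => ?_)
  ext w
  exact alt_vecCons_swap (om.1 q) v u w

lemma contr_biv {k : ℕ} (om : Form (k + 2)) :
    contr biv om = contrVec (e 2) (contrVec (e 3) om) := by
  have hsum (X : Fin 4 → Fin 4 → Form k) :
      ∑ i, ∑ j, fmul (biv.comp i j) (X i j) = X 2 3 - X 3 2 := by
    simp only [biv, fmul_algebraMap]
    simp [sub_smul, ite_and, ite_smul]
  rw [contr, hsum, contrVec_swap (e 3) (e 2)]
  module

lemma coeff1_lieD (om : Form 2) (i : Fin 4) :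
    coeff1 (lieD biv om) i = pder 3 (coeff2 om 2 i) - pder 2 (coeff2 om 3 i) := by
  have h : coeff1 (lieD biv om) i
      = coeff3 (d om) 3 2 i - pder i (coeff2 om 3 2) := by
    rw [lieD, contr_biv, contr_biv]
    exact (map_sub _ _ _).trans (congrArg _ (coeff1_d _ i))
  rw [h, coeff3_d]
  ring

@[simp]
lemma wedge_zero_left {r s n : ℕ} (h : r + s = n) (β : Form s) : wedge h 0 β = 0 :=
  Subtype.ext (funext fun q => LinearMap.map_zero₂ (isBilinearMap_wedgeAlt h).toLinearMap (β.1 q))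

@[simp]
lemma wedge_zero_right {r s n : ℕ} (h : r + s = n) (α : Form r) : wedge h α 0 = 0 :=
  Subtype.ext (funext fun q => map_zero ((isBilinearMap_wedgeAlt h).toLinearMap (α.1 q)))

@[simp]
lemma contr_zero {k : ℕ} (Z : Bivector) : contr Z (0 : Form (k + 2)) = 0 := by
  have h (i j : Fin 4) :
      fmul (Z.comp i j) (contrVec (e i) (contrVec (e j) (0 : Form (k + 2)))) = 0 :=
    Subtype.ext (funext fun _ => smul_zero _)
  simp only [contr, h, Finset.sum_const_zero, smul_zero]

@[simp]
lemma lieD_zero (Z : Bivector) : {k : ℕ} → lieD Z (0 : Form (k + 1)) = 0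
  | 0 => by rw [lieD, map_zero, contr_zero]
  | _ + 1 => by rw [lieD, map_zero, contr_zero, contr_zero, map_zero, sub_zero]

lemma lam2_zero_left (Z : Bivector) {r s : ℕ} (β : Form (s + 1)) :
    lam2 Z (0 : Form (r + 1)) β = 0 := by
  simp [lam2, koszul]

lemma lam2_zero_right (Z : Bivector) {r s : ℕ} (α : Form (r + 1)) :
    lam2 Z α (0 : Form (s + 1)) = 0 := by
  simp [lam2, koszul]

lemma koszul_two_two (α β : Form 2) :
    koszul biv α β = d (contr biv (wedge (n := 4) rfl α β))
      + wedge rfl (lieD biv α) β + wedge rfl α (lieD biv β) := by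
  have hkoszul : koszul biv α β = (-1 : ℝ) ^ (1 + 1 + 1) •
      (lieD biv (wedge (n := 4) rfl α β)
        - wedge rfl (lieD biv α) β - (-1 : ℝ) ^ (1 + 1) • wedge rfl α (lieD biv β)) := by
    unfold koszul
    congr 1
  have hlie : lieD biv (wedge (n := 4) rfl α β) = -d (contr biv (wedge (n := 4) rfl α β)) := by
    rw [lieD, form_eq_zero_of_lt (by norm_num) (d (wedge (n := 4) rfl α β)), contr_zero, zero_sub]
  rw [hkoszul, hlie]
  module

lemma lam2_eq_koszul (α β : Form 2) : lam2 biv α β = koszul biv α β := by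
  rw [lam2, show (-1 : ℝ) ^ (1 + 1) = 1 by norm_num]
  exact one_smul ℝ _

lemma lam3_biv {r s t : ℕ} (α : Form (r + 1)) (β : Form (s + 1)) (γ : Form (t + 1)) :
    lam3 biv α β γ = 0 := by
  have hconst (l i j : Fin 4) : pderiv l (biv.comp i j) = 0 := (pder l).map_algebraMap _
  have hschouten (i j k : Fin 4) : biv.halfSchouten i j k = algebraMap ℝ smoothFun 0 := by
    simp [Bivector.halfSchouten, hconst]
  simp only [lam3, koszul3, hschouten, fmul_algebraMap, zero_smul, Finset.sum_const_zero,
    smul_zero]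

/-- The 2-form `ι_{∂₃} w ∧ ι_{∂₄} w`; for closed `w` it is half of a primitive of `λ₂(w, w)`. Its
component along the leaves of `K` is the mixed part `w₂₀ w₃₁ - w₂₁ w₃₀` of the Pfaffian of `w`. -/
def transverseWedge (w : Form 2) : Form 2 :=
  wedge rfl (contrVec (e 2) w) (contrVec (e 3) w)

lemma coeff2_transverseWedge (w : Form 2) (i j : Fin 4) :
    coeff2 (transverseWedge w) i j = coeff2 w 2 i * coeff2 w 3 j - coeff2 w 2 j * coeff2 w 3 i :=
  coeff2_wedge rfl (contrVec (e 2) w) (contrVec (e 3) w) i j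

lemma coeff3_lam2_self (w : Form 2) (i j k : Fin 4) :
    coeff3 (lam2 biv w w) i j k
      = 2 * (coeff3 (d (transverseWedge w)) i j k - coeff2 w 2 3 * coeff3 (d w) i j k
        + coeff2 w j k * coeff3 (d w) 3 2 i - coeff2 w i k * coeff3 (d w) 3 2 j
        + coeff2 w i j * coeff3 (d w) 3 2 k) := by
  have hcontr (i j : Fin 4) : coeff2 (contr biv (wedge (n := 4) rfl w w)) i j = _ :=
    (congrArg (Form.eval ![e i, e j]) (contr_biv _)).trans (eval_wedge_two_two rfl w w 3 2 i j)
  have hlam : coeff3 (lam2 biv w w) i j k = coeff3 (d (contr biv (wedge (n := 4) rfl w w))) i j k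
      + coeff3 (wedge rfl (lieD biv w) w) i j k + coeff3 (wedge rfl w (lieD biv w)) i j k := by
    rw [lam2_eq_koszul, koszul_two_two]
    rfl
  rw [hlam, coeff3_wedge_one_two, coeff3_wedge_two_one, coeff2_swap w 2 3]
  simp only [coeff1_lieD, coeff3_d, hcontr, coeff2_transverseWedge, map_add, map_sub,
    Derivation.leibniz, smul_eq_mul]
  ring

lemma lam2_self_eq_d_transverseWedge {w : Form 2} (hw : d w = 0) :
    lam2 biv w w = (2 : ℝ) • d (transverseWedge w) := by
  refine Form.ext_coeff3 fun i j k => ?_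
  have hzero (i j k : Fin 4) : coeff3 (d w) i j k = 0 := by
    rw [hw]
    exact map_zero _
  rw [coeff3_lam2_self, hzero, hzero, hzero, hzero, two_smul, two_mul]
  refine Eq.trans ?_ (map_add (Form.eval _) _ _).symm
  simp only [mul_zero, sub_zero, add_zero]

/-! ### The pre-symplectic form `η = dθ₃ ∧ dθ₄` -/

lemma e_apply (i j : Fin 4) : e i j = if j = i then 1 else 0 := Pi.single_apply i 1 j

lemma dθ2_apply (i j : Fin 4) (u v : V) : dθ2 i j ![u, v] = u i * v j - v i * u j :=
  wedgeAlt_one_one rfl (dθ i) (dθ j) u v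

lemma flat_eta_apply (q : T4) (v w : V) : flat eta q v w = v 2 * w 3 - w 2 * v 3 :=
  (flat_apply eta q v w).trans (dθ2_apply 2 3 v w)

lemma mem_kerAt_eta {q : T4} {v : V} : v ∈ kerAt eta q ↔ v 2 = 0 ∧ v 3 = 0 := by
  refine ⟨fun h => ?_, fun ⟨h2, h3⟩ => ContinuousLinearMap.ext fun w => ?_⟩
  · have h0 (w : V) : flat eta q v w = 0 := DFunLike.congr_fun (LinearMap.mem_ker.1 h) w
    have h3 := h0 (e 2)
    have h2 := h0 (e 3)
    simp only [flat_eta_apply, e_apply] at h2 h3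
    simpa using And.intro h2 h3
  · rw [flat_eta_apply, h2, h3]
    simp

lemma mem_span_e_zero_one {v : V} : v ∈ Submodule.span ℝ {e 0, e 1} ↔ v 2 = 0 ∧ v 3 = 0 := by
  rw [Submodule.mem_span_pair]
  refine ⟨?_, fun ⟨h2, h3⟩ => ⟨v 0, v 1, ?_⟩⟩
  · rintro ⟨a, b, rfl⟩
    simp [e_apply]
  · ext i
    fin_cases i <;> simp [e_apply, h2, h3]

lemma mem_G34 {q : T4} {v : V} : v ∈ G34 q ↔ v 0 = 0 ∧ v 1 = 0 := by
  rw [G34, Submodule.mem_span_pair]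
  refine ⟨?_, fun ⟨h0, h1⟩ => ⟨v 2, v 3, ?_⟩⟩
  · rintro ⟨a, b, rfl⟩
    simp [e_apply]
  · ext i
    fin_cases i <;> simp [e_apply, h0, h1]

lemma kerAt_eta (q : T4) : kerAt eta q = Submodule.span ℝ {e 0, e 1} := by
  ext v
  rw [mem_kerAt_eta, mem_span_e_zero_one]

lemma finrank_kerAt_eta (q : T4) : Module.finrank ℝ (kerAt eta q) = 2 := by
  have hindep : LinearIndependent ℝ ![e 0, e 1] :=
    LinearIndependent.pair_iff.2 fun a b hab =>
      ⟨by simpa [e_apply] using congrFun hab 0, by simpa [e_apply] using congrFun hab 1⟩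
  have h := finrank_span_eq_card hindep
  rwa [Matrix.range_cons_cons_empty, ← kerAt_eta q, Fintype.card_fin] at h

lemma d_eta : d eta = 0 := by
  refine Form.ext_coeff3 fun i j k => ?_
  have hconst (l i j : Fin 4) : pder l (coeff2 eta i j) = 0 :=
    (pder l).map_algebraMap (dθ2 2 3 ![e i, e j])
  rw [coeff3_d, hconst, hconst, hconst]
  simp

lemma isPreSymplectic_eta : IsPreSymplectic 2 eta := by
  refine ⟨d_eta, fun q => ?_⟩
  have h := (flat eta q).finrank_range_add_finrank_ker
  rw [← kerAt, finrank_kerAt_eta, Module.finrank_fin_fun] at h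
  omega

lemma biv_sharp (q : T4) (ξ : V →L[ℝ] ℝ) :
    biv.sharp q ξ = ξ (e 2) • e 3 - ξ (e 3) • e 2 := by
  have hcomp (i j : Fin 4) : (biv.comp i j).1 q
      = (if i = 2 ∧ j = 3 then 1 else 0) - (if i = 3 ∧ j = 2 then 1 else 0) := rfl
  change ∑ i, ∑ j, ((biv.comp i j).1 q * ξ (e i)) • e j = _
  simp [Fin.sum_univ_four, hcomp, sub_eq_add_neg]

lemma isCompl_kerAt_eta_G34 (q : T4) : IsCompl (kerAt eta q) (G34 q) := by
  constructor
  · refine Submodule.disjoint_def.2 fun v hK hG => ?_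
    rw [mem_kerAt_eta] at hK
    rw [mem_G34] at hG
    ext i
    fin_cases i
    exacts [hG.1, hG.2, hK.1, hK.2]
  · refine codisjoint_iff.2 (eq_top_iff.2 fun v _ => Submodule.mem_sup.2
      ⟨v 0 • e 0 + v 1 • e 1, ?_, v 2 • e 2 + v 3 • e 3, ?_, ?_⟩)
    · simp [mem_kerAt_eta, e_apply]
    · simp [mem_G34, e_apply]
    · ext i
      fin_cases i <;> simp [e_apply]

lemma isNegInverse_biv : IsNegInverse eta G34 biv := by
  refine fun q => ⟨isCompl_kerAt_eta_G34 q, ?_, fun v hv => ?_⟩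
  · rintro _ ⟨ξ, rfl⟩
    simp [biv_sharp, mem_G34, e_apply]
  · rw [mem_G34] at hv
    rw [biv_sharp, flat_eta_apply, flat_eta_apply]
    ext i
    fin_cases i <;> simp [e_apply, hv.1, hv.2]

/-! ### Horizontal forms -/

lemma mem_horForm_of_finrank_kerAt_lt {η : Form 2} {k : ℕ}
    (hη : ∀ q, Module.finrank ℝ (kerAt η q) < k) (om : Form k) : om ∈ horForm η k := by
  refine fun q v hv => (om.1 q).toAlternatingMap.map_linearDependent v fun h => ?_
  have h' : LinearIndependent ℝ (fun i => (⟨v i, hv i⟩ : kerAt η q)) :=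
    LinearIndependent.of_comp (kerAt η q).subtype h
  exact (hη q).not_ge (by simpa using h'.fintype_card_le_finrank)

lemma e_zero_mem_kerAt_eta (q : T4) : e 0 ∈ kerAt eta q := by simp [mem_kerAt_eta, e_apply]

lemma e_one_mem_kerAt_eta (q : T4) : e 1 ∈ kerAt eta q := by simp [mem_kerAt_eta, e_apply]

lemma coeff1_zero_of_mem_horForm {α : Form 1} (hα : α ∈ horForm eta 1) : coeff1 α 0 = 0 :=
  Subtype.ext (funext fun q => hα q _ (by simp [e_zero_mem_kerAt_eta]))

lemma coeff1_one_of_mem_horForm {α : Form 1} (hα : α ∈ horForm eta 1) : coeff1 α 1 = 0 :=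
  Subtype.ext (funext fun q => hα q _ (by simp [e_one_mem_kerAt_eta]))

lemma mem_horForm_two {w : Form 2} : w ∈ horForm eta 2 ↔ coeff2 w 0 1 = 0 := by
  refine ⟨fun hw => Subtype.ext (funext fun q => hw q _ ?_), fun h q v hv => ?_⟩
  · simp [Fin.forall_fin_two, e_zero_mem_kerAt_eta, e_one_mem_kerAt_eta]
  · have hflat (i j : Fin 4) : flat w q (e i) (e j) = (coeff2 w i j).1 q :=
      flat_apply w q (e i) (e j)
    obtain ⟨a, b, hab⟩ := Submodule.mem_span_pair.1 (kerAt_eta q ▸ hv 0)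
    obtain ⟨a', b', hab'⟩ := Submodule.mem_span_pair.1 (kerAt_eta q ▸ hv 1)
    have hv' : v = ![v 0, v 1] := by
      ext i : 1
      fin_cases i <;> rfl
    rw [hv', ← flat_apply, ← hab, ← hab']
    simp [hflat, coeff2_self, coeff2_swap w 1 0, h]

lemma d_d {k : ℕ} (om : Form k) : d (d om) = 0 := by
  refine Subtype.ext (funext fun q => ?_)
  obtain ⟨x, rfl⟩ := proj_surjective q
  have hsmooth : minSmoothness ℝ 2 ≤ ∞ := by
    rw [minSmoothness_of_isRCLikeNormedField]
    exact WithTop.coe_le_coe.2 le_top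
  rw [d_apply_proj, funext (d_apply_proj om), extDeriv_extDeriv om.smooth hsmooth]
  rfl

lemma lam2_mem_closedHor (w : closedHor eta 2) : lam2 biv w.1 w.1 ∈ closedHor eta 3 := by
  refine ⟨mem_horForm_of_finrank_kerAt_lt (fun q => by rw [finrank_kerAt_eta]; norm_num) _, ?_⟩
  rw [SetLike.mem_coe, LinearMap.mem_ker, lam2_self_eq_d_transverseWedge w.2.2, map_smul, d_d,
    smul_zero]

/-! ### The Kuranishi map -/

lemma cls_eq_iff {η : Form 2} {k : ℕ} {w w' : closedHor η (k + 1)} :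
    cls w = cls w' ↔ ∃ α ∈ horForm η k, d α = w.1 - w'.1 := by
  rw [cls, cls, Submodule.Quotient.eq]
  rfl

lemma pder_coeff2_comm_of_mem_closedHor (w : closedHor eta 2) (k : Fin 4) :
    pder 0 (coeff2 w.1 k 1) = pder 1 (coeff2 w.1 k 0) := by
  have h := closed_coeff w.2.2 0 k 1
  rw [mem_horForm_two.1 w.2.1, coeff2_swap _ 0 k, map_zero, map_neg] at h
  linear_combination h

-- On `K` one has `ι_{∂ₖ} dα = -d(α(∂ₖ))`, because `α` vanishes on `K`.
lemma transverseWedge_sub_sub_d_mem_horForm {w w' : closedHor eta 2} {α : Form 1}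
    (hα : α ∈ horForm eta 1) (hdα : d α = w'.1 - w.1) :
    transverseWedge w'.1 - transverseWedge w.1
      - d (fmul (coeff1 α 3) (contrVec (e 2) w.1) - fmul (coeff1 α 2) (contrVec (e 3) w'.1))
      ∈ horForm eta 2 := by
  set γ := fmul (coeff1 α 3) (contrVec (e 2) w.1) - fmul (coeff1 α 2) (contrVec (e 3) w'.1)
  have hγ (i : Fin 4) : coeff1 γ i
      = coeff1 α 3 * coeff2 w.1 2 i - coeff1 α 2 * coeff2 w'.1 3 i := rfl
  have hw' (i j : Fin 4) : coeff2 w'.1 i j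
      = coeff2 w.1 i j + (pder i (coeff1 α j) - pder j (coeff1 α i)) := by
    rw [← coeff2_d, hdα]
    exact (add_sub_cancel _ _).symm
  have hzero (k : Fin 4) : coeff2 w'.1 k 0 = coeff2 w.1 k 0 - pder 0 (coeff1 α k) := by
    rw [hw', coeff1_zero_of_mem_horForm hα, map_zero, zero_sub, sub_eq_add_neg]
  have hone (k : Fin 4) : coeff2 w'.1 k 1 = coeff2 w.1 k 1 - pder 1 (coeff1 α k) := by
    rw [hw', coeff1_one_of_mem_horForm hα, map_zero, zero_sub, sub_eq_add_neg]
  have hcoeff : coeff2 (transverseWedge w'.1 - transverseWedge w.1 - d γ) 0 1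
      = coeff2 (transverseWedge w'.1) 0 1 - coeff2 (transverseWedge w.1) 0 1
        - coeff2 (d γ) 0 1 := rfl
  rw [mem_horForm_two, hcoeff, coeff2_transverseWedge, coeff2_transverseWedge, coeff2_d, hγ, hγ]
  simp only [map_sub, Derivation.leibniz, smul_eq_mul]
  linear_combination coeff2 w'.1 3 1 * hzero 2 - coeff2 w'.1 3 0 * hone 2
    + coeff2 w.1 2 0 * hone 3 - coeff2 w.1 2 1 * hzero 3
    - coeff1 α 3 * pder_coeff2_comm_of_mem_closedHor w 2
    + coeff1 α 2 * pder_coeff2_comm_of_mem_closedHor w' 3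

lemma cls_lam2_eq_of_cls_eq {w w' : closedHor eta 2} (h : cls w = cls w') :
    cls ⟨lam2 biv w.1 w.1, lam2_mem_closedHor w⟩
      = cls ⟨lam2 biv w'.1 w'.1, lam2_mem_closedHor w'⟩ := by
  obtain ⟨α, hα, hdα⟩ := cls_eq_iff.1 h
  have hprimitive := (horForm eta 2).smul_mem (2 : ℝ) (transverseWedge_sub_sub_d_mem_horForm hα hdα)
  refine cls_eq_iff.2 ⟨_, hprimitive, ?_⟩
  change _ = lam2 biv w.1 w.1 - lam2 biv w'.1 w'.1
  rw [map_smul, map_sub, map_sub, d_d, sub_zero, smul_sub, lam2_self_eq_d_transverseWedge w.2.2,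
    lam2_self_eq_d_transverseWedge w'.2.2]

/-- The Kuranishi map `[w] ↦ [λ₂(w, w)]`. -/
def kuranishi : HHor eta 1 → HHor eta 2 :=
  Quotient.lift (fun w => cls ⟨lam2 biv w.1 w.1, lam2_mem_closedHor w⟩)
    fun _ _ h => cls_lam2_eq_of_cls_eq (Quotient.sound h)

lemma kuranishi_cls (w : closedHor eta 2) :
    kuranishi (cls w) = cls ⟨lam2 biv w.1 w.1, lam2_mem_closedHor w⟩ := rfl

/-! ### Integration over the leaves of `K` -/

/-- The point `(p₁, p₂, s, u)` of `ℝ⁴`, on the leaf of `K` over `(θ₃, θ₄) = (s, u)`. -/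
def leafPoint (s u : ℝ) (p : ℝ × ℝ) : V := p.1 • e 0 + p.2 • e 1 + (s • e 2 + u • e 3)

/-- The fundamental domain `[0, 2π]²` of a leaf of `K`. -/
def leafBox : Set (ℝ × ℝ) := Set.Icc (0, 0) (2 * Real.pi, 2 * Real.pi)

lemma isCompact_leafBox : IsCompact leafBox := isCompact_Icc

lemma leafPoint_apply (s u : ℝ) (p : ℝ × ℝ) : leafPoint s u p = ![p.1, p.2, s, u] := by
  ext i
  fin_cases i <;> simp [leafPoint, e_apply]

lemma proj_leafPoint_right (s u x : ℝ) :
    proj (leafPoint s u (2 * Real.pi, x)) = proj (leafPoint s u (0, x)) := by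
  rw [leafPoint_apply, leafPoint_apply]
  funext i
  fin_cases i
  · exact AddCircle.coe_period _
  all_goals rfl

lemma proj_leafPoint_top (s u x : ℝ) :
    proj (leafPoint s u (x, 2 * Real.pi)) = proj (leafPoint s u (x, 0)) := by
  rw [leafPoint_apply, leafPoint_apply]
  funext i
  fin_cases i
  · rfl
  · exact AddCircle.coe_period _
  all_goals rfl

lemma continuous_uncurry_leaf (f : smoothFun) (u : ℝ) :
    Continuous fun z : ℝ × (ℝ × ℝ) => f.1 (proj (leafPoint z.1 u z.2)) := by
  refine (ContDiff.continuous (n := ∞) f.2).comp (g := fun x => f.1 (proj x)) ?_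
  unfold leafPoint
  fun_prop

lemma continuous_leaf (f : smoothFun) (s u : ℝ) :
    Continuous fun p : ℝ × ℝ => f.1 (proj (leafPoint s u p)) :=
  (continuous_uncurry_leaf f u).comp (Continuous.prodMk_right s)

lemma integrableOn_leaf (f : smoothFun) (s u : ℝ) :
    MeasureTheory.IntegrableOn (fun p => f.1 (proj (leafPoint s u p))) leafBox :=
  (continuous_leaf f s u).continuousOn.integrableOn_compact isCompact_leafBox

/-- Integration of functions over the leaf `θ₃ = s`, `θ₄ = u` of `K`. -/
def leafIntegral (s u : ℝ) : smoothFun →ₗ[ℝ] ℝ where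
  toFun f := ∫ p in leafBox, f.1 (proj (leafPoint s u p))
  map_add' f g := MeasureTheory.integral_add (integrableOn_leaf f s u) (integrableOn_leaf g s u)
  map_smul' c f := MeasureTheory.integral_const_mul c fun p => f.1 (proj (leafPoint s u p))

lemma leafIntegral_apply (s u : ℝ) (f : smoothFun) :
    leafIntegral s u f = ∫ p in leafBox, f.1 (proj (leafPoint s u p)) := rfl

lemma leafIntegral_of_eq_const {f : smoothFun} {s u c : ℝ}
    (h : ∀ p, f.1 (proj (leafPoint s u p)) = c) :
    leafIntegral s u f = (2 * Real.pi) ^ 2 * c := by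
  have hvol : MeasureTheory.volume.real leafBox = (2 * Real.pi) ^ 2 := by
    rw [leafBox, Set.Icc_prod_eq, MeasureTheory.Measure.volume_eq_prod,
      MeasureTheory.measureReal_prod_prod, Real.volume_real_Icc_of_le Real.two_pi_pos.le, sub_zero,
      sq]
  rw [leafIntegral_apply, MeasureTheory.integral_congr_ae (.of_forall h),
    MeasureTheory.setIntegral_const, hvol, smul_eq_mul]

lemma leafIntegral_divergence (p q : smoothFun) (s u : ℝ) :
    leafIntegral s u (pder 0 p + pder 1 q) = 0 := by
  let D : ℝ × ℝ →L[ℝ] V := (ContinuousLinearMap.fst ℝ ℝ ℝ).smulRight (e 0)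
    + (ContinuousLinearMap.snd ℝ ℝ ℝ).smulRight (e 1)
  let f' (f : smoothFun) (z : ℝ × ℝ) : ℝ × ℝ →L[ℝ] ℝ :=
    (fderiv ℝ (fun x => f.1 (proj x)) (leafPoint s u z)).comp D
  have hderiv (f : smoothFun) (z : ℝ × ℝ) :
      HasFDerivAt (fun z => f.1 (proj (leafPoint s u z))) (f' f z) z :=
    (smoothFun_differentiableAt f _).hasFDerivAt.comp z (D.hasFDerivAt.add_const _)
  have h0 (f : smoothFun) (z : ℝ × ℝ) : f' f z (1, 0) = (pder 0 f).1 (proj (leafPoint s u z)) := by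
    simp [f', D, pder_apply_proj]
  have h1 (f : smoothFun) (z : ℝ × ℝ) : f' f z (0, 1) = (pder 1 f).1 (proj (leafPoint s u z)) := by
    simp [f', D, pder_apply_proj]
  have h := MeasureTheory.integral_divergence_prod_Icc_of_hasFDerivAt_of_le
    (fun z => p.1 (proj (leafPoint s u z))) (fun z => q.1 (proj (leafPoint s u z))) (f' p) (f' q)
    (0, 0) (2 * Real.pi, 2 * Real.pi) ⟨Real.two_pi_pos.le, Real.two_pi_pos.le⟩
    (continuous_leaf p s u).continuousOn (continuous_leaf q s u).continuousOn
    (fun z _ => hderiv p z) (fun z _ => hderiv q z) (by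
      simp only [h0, h1]
      exact integrableOn_leaf (pder 0 p + pder 1 q) s u)
  simp only [h0, h1, proj_leafPoint_right, proj_leafPoint_top, sub_self, zero_add] at h
  exact h

lemma leafIntegral_sub_eq_integral (r : smoothFun) (s s' u : ℝ) :
    leafIntegral s u r - leafIntegral s' u r = ∫ σ in s'..s, leafIntegral σ u (pder 2 r) := by
  have hderiv (z : ℝ × ℝ) (σ : ℝ) : HasDerivAt (fun σ => r.1 (proj (leafPoint σ u z)))
      ((pder 2 r).1 (proj (leafPoint σ u z))) σ := by
    have hline : HasDerivAt (fun σ : ℝ => σ • e 2 + u • e 3) (e 2) σ := by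
      simpa using ((hasDerivAt_id σ).smul_const (e 2)).add_const (u • e 3)
    rw [pder_apply_proj]
    exact (smoothFun_differentiableAt r _).hasFDerivAt.comp_hasDerivAt σ (hline.const_add _)
  have hcont (z : ℝ × ℝ) : Continuous fun σ => (pder 2 r).1 (proj (leafPoint σ u z)) :=
    (continuous_uncurry_leaf (pder 2 r) u).comp (Continuous.prodMk_left z)
  have hftc (z : ℝ × ℝ) : r.1 (proj (leafPoint s u z)) - r.1 (proj (leafPoint s' u z))
      = ∫ σ in s'..s, (pder 2 r).1 (proj (leafPoint σ u z)) :=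
    (intervalIntegral.integral_eq_sub_of_hasDerivAt (fun σ _ => hderiv z σ)
      ((hcont z).intervalIntegrable _ _)).symm
  rw [leafIntegral_apply, leafIntegral_apply, ← MeasureTheory.integral_sub
    (integrableOn_leaf r s u) (integrableOn_leaf r s' u)]
  simp only [hftc]
  refine (MeasureTheory.intervalIntegral_integral_swap ?_).symm
  rw [Set.uIoc, MeasureTheory.Measure.prod_restrict]
  refine MeasureTheory.IntegrableOn.mono_set (t := Set.Icc (min s' s) (max s' s) ×ˢ leafBox)
    ?_ (Set.prod_mono Set.Ioc_subset_Icc_self subset_rfl)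
  exact (continuous_uncurry_leaf (pder 2 r) u).continuousOn.integrableOn_compact
    (isCompact_Icc.prod isCompact_leafBox)

lemma leafIntegral_eq_of_divergence_eq_zero {p q r : smoothFun}
    (h : pder 0 p + pder 1 q + pder 2 r = 0) (s s' u : ℝ) :
    leafIntegral s u r = leafIntegral s' u r := by
  have hr : pder 2 r = -(pder 0 p + pder 1 q) := by linear_combination h
  simp only [← sub_eq_zero, leafIntegral_sub_eq_integral, hr, map_neg, leafIntegral_divergence,
    neg_zero, intervalIntegral.integral_zero]

/-- Integration of 2-forms over the leaf `θ₃ = s`, `θ₄ = u` of `K`. -/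
def leafPeriod (s u : ℝ) : Form 2 →ₗ[ℝ] ℝ := leafIntegral s u ∘ₗ Form.eval ![e 0, e 1]

lemma leafPeriod_apply (s u : ℝ) (w : Form 2) :
    leafPeriod s u w = leafIntegral s u (coeff2 w 0 1) := rfl

lemma leafPeriod_d (α : Form 1) (s u : ℝ) : leafPeriod s u (d α) = 0 := by
  rw [leafPeriod_apply, coeff2_d, sub_eq_add_neg, ← map_neg, leafIntegral_divergence]

lemma leafPeriod_of_mem_horForm {w : Form 2} (hw : w ∈ horForm eta 2) (s u : ℝ) :
    leafPeriod s u w = 0 := by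
  rw [leafPeriod_apply, mem_horForm_two.1 hw, map_zero]

lemma leafPeriod_eq_of_closed {w : Form 2} (hw : d w = 0) (s s' u : ℝ) :
    leafPeriod s u w = leafPeriod s' u w := by
  refine leafIntegral_eq_of_divergence_eq_zero (p := coeff2 w 1 2) (q := -coeff2 w 0 2) ?_ s s' u
  rw [map_neg, ← sub_eq_add_neg]
  exact closed_coeff hw 0 1 2

/-! ### Leaf periods of `ι_{∂₃}w ∧ ι_{∂₄}w` -/

lemma leafPeriod_transverseWedge_eq_of_cls_eq {w w' : closedHor eta 2} (h : cls w = cls w')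
    (s u : ℝ) :
    leafPeriod s u (transverseWedge w.1) = leafPeriod s u (transverseWedge w'.1) := by
  obtain ⟨α, hα, hdα⟩ := cls_eq_iff.1 h
  have hzero := leafPeriod_of_mem_horForm (transverseWedge_sub_sub_d_mem_horForm hα hdα) s u
  rw [map_sub, map_sub, leafPeriod_d, sub_zero] at hzero
  exact sub_eq_zero.1 hzero

lemma kuranishi_cls_eq_zero_iff {w : closedHor eta 2} :
    kuranishi (cls w) = 0 ↔ ∃ β ∈ horForm eta 2, d β = lam2 biv w.1 w.1 := by
  rw [kuranishi_cls, ← Submodule.Quotient.mk_zero]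
  exact cls_eq_iff.trans (by simp only [ZeroMemClass.coe_zero, sub_zero])

lemma leafPeriod_transverseWedge_eq_of_kuranishi_eq_zero {w : closedHor eta 2}
    (h : kuranishi (cls w) = 0) (s s' u : ℝ) :
    leafPeriod s u (transverseWedge w.1) = leafPeriod s' u (transverseWedge w.1) := by
  obtain ⟨β, hβ, hdβ⟩ := kuranishi_cls_eq_zero_iff.1 h
  have hclosed : d ((2 : ℝ) • transverseWedge w.1 - β) = 0 := by
    rw [map_sub, map_smul, hdβ, lam2_self_eq_d_transverseWedge w.2.2, sub_self]
  have h' := leafPeriod_eq_of_closed hclosed s s' u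
  simp only [map_sub, map_smul, leafPeriod_of_mem_horForm hβ, sub_zero] at h'
  exact smul_right_injective ℝ two_ne_zero h'

/-! ### The forms `f(θ₃) dθ₁ ∧ dθ₃ + g(θ₄) dθ₂ ∧ dθ₄` -/

section FormB

/-- The function `f(θᵢ)` on `T⁴`. -/
def angleFun (i : Fin 4) {f : S1 → ℝ} (hf : IsSmoothS1 f) : smoothFun :=
  ⟨fun q => f (q i), comp_coord_smooth hf i⟩

lemma pder_angleFun (l i : Fin 4) {f : S1 → ℝ} (hf : IsSmoothS1 f) (x : V) :
    (pder l (angleFun i hf)).1 (proj x) = deriv (fun t : ℝ => f t) (x i) * e l i := by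
  have hderiv : HasDerivAt (fun t : ℝ => f t) (deriv (fun t : ℝ => f t) (x i)) (x i) :=
    (ContDiff.differentiable (n := ∞) hf (by simp)).differentiableAt.hasDerivAt
  have hcomp := hderiv.comp_hasFDerivAt x
    (ContinuousLinearMap.proj (R := ℝ) (φ := fun _ : Fin 4 => ℝ) i).hasFDerivAt
  rw [pder_apply_proj]
  exact DFunLike.congr_fun hcomp.fderiv (e l)

lemma dθ_apply (i : Fin 4) (v : V) : dθ i ![v] = v i := rfl

lemma dθ3_apply (i j k : Fin 4) (u v w : V) :
    dθ3 i j k ![u, v, w] = w k * (u i * v j - v i * u j) - v k * (u i * w j - w i * u j)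
      + u k * (v i * w j - w i * v j) := by
  rw [dθ3, wedgeAlt_two_one]
  simp only [dθ2_apply, dθ_apply]
  ring

variable {f g : S1 → ℝ} (hf : IsSmoothS1 f) (hg : IsSmoothS1 g)

lemma coeff2_formB (i j : Fin 4) :
    coeff2 (formB f g hf hg) i j
      = dθ2 0 2 ![e i, e j] • angleFun 2 hf + dθ2 1 3 ![e i, e j] • angleFun 3 hg := by
  refine smoothFun_ext fun x => ?_
  change f _ * dθ2 0 2 ![e i, e j] + g _ * dθ2 1 3 ![e i, e j] = _ * f _ + _ * g _
  ring

lemma formB_mem_closedHor : formB f g hf hg ∈ closedHor eta 2 := by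
  refine ⟨mem_horForm_two.2 ?_, LinearMap.mem_ker.2 (Form.ext_coeff3 fun i j k => ?_)⟩
  · rw [coeff2_formB]
    simp [dθ2_apply, e_apply]
  · have hpder (l i j : Fin 4) (x : V) : (pder l (coeff2 (formB f g hf hg) i j)).1 (proj x)
        = dθ2 0 2 ![e i, e j] * (deriv (fun t : ℝ => f t) (x 2) * e l 2)
          + dθ2 1 3 ![e i, e j] * (deriv (fun t : ℝ => g t) (x 3) * e l 3) := by
      rw [coeff2_formB, map_add, Derivation.map_smul, Derivation.map_smul, ← pder_angleFun l 2 hf,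
        ← pder_angleFun l 3 hg]
      rfl
    rw [coeff3_d]
    refine smoothFun_ext fun x => ?_
    change _ - _ + _ = (0 : ℝ)
    rw [hpder, hpder, hpder]
    simp only [dθ2_apply]
    ring

lemma coeff2_transverseWedge_formB (i j : Fin 4) :
    coeff2 (transverseWedge (formB f g hf hg)) i j
      = dθ2 0 1 ![e i, e j] • (angleFun 2 hf * angleFun 3 hg) := by
  have htwo (i : Fin 4) : coeff2 (formB f g hf hg) 2 i = (-e i 0) • angleFun 2 hf := by
    rw [coeff2_formB]
    simp [dθ2_apply, e_apply]
  have hthree (i : Fin 4) : coeff2 (formB f g hf hg) 3 i = (-e i 1) • angleFun 3 hg := by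
    rw [coeff2_formB]
    simp [dθ2_apply, e_apply]
  simp only [coeff2_transverseWedge, htwo, hthree, dθ2_apply, smul_mul_smul_comm, ← sub_smul]
  congr 1
  ring

lemma koszul_formB (x : V) :
    (koszul biv (formB f g hf hg) (formB f g hf hg)).1 (proj x)
      = (2 : ℝ) • ((f (x 2) * deriv (fun t : ℝ => g t) (x 3)) • dθ3 0 1 3
        + (g (x 3) * deriv (fun t : ℝ => f t) (x 2)) • dθ3 0 1 2) := by
  set T := transverseWedge (formB f g hf hg)
  have hpder (l i j : Fin 4) : (pder l (coeff2 T i j)).1 (proj x)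
      = dθ2 0 1 ![e i, e j] * (f (x 2) * (deriv (fun t : ℝ => g t) (x 3) * e l 3)
        + g (x 3) * (deriv (fun t : ℝ => f t) (x 2) * e l 2)) := by
    rw [coeff2_transverseWedge_formB, Derivation.map_smul, Derivation.leibniz,
      ← pder_angleFun l 2 hf, ← pder_angleFun l 3 hg]
    rfl
  have hd (i j k : Fin 4) : (coeff3 (d T) i j k).1 (proj x) = (pder i (coeff2 T j k)).1 (proj x)
      - (pder j (coeff2 T i k)).1 (proj x) + (pder k (coeff2 T i j)).1 (proj x) := by
    rw [coeff3_d]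
    rfl
  rw [← lam2_eq_koszul, lam2_self_eq_d_transverseWedge (formB_mem_closedHor hf hg).2]
  refine alt_three_ext fun i j k => ?_
  change 2 * (coeff3 (d T) i j k).1 (proj x)
    = 2 * (_ * dθ3 0 1 3 ![e i, e j, e k] + _ * dθ3 0 1 2 ![e i, e j, e k])
  rw [hd, hpder, hpder, hpder]
  simp only [dθ2_apply, dθ3_apply]
  ring

lemma leafPeriod_transverseWedge_formB (s u : ℝ) :
    leafPeriod s u (transverseWedge (formB f g hf hg)) = (2 * Real.pi) ^ 2 * (f s * g u) := by
  refine leafIntegral_of_eq_const fun p => ?_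
  have hcoeff : coeff2 (transverseWedge (formB f g hf hg)) 0 1 = angleFun 2 hf * angleFun 3 hg := by
    rw [coeff2_transverseWedge_formB]
    simp [dθ2_apply, e_apply]
  change (coeff2 (transverseWedge (formB f g hf hg)) 0 1).1 _ = _
  rw [hcoeff, leafPoint_apply]
  rfl

lemma exists_leafPeriod_transverseWedge_ne (h : ∃ a b : S1, g 0 * (f b - f a) ≠ 0)
    {w : closedHor eta 2} (hw : cls w = cls ⟨formB f g hf hg, formB_mem_closedHor hf hg⟩) :
    ∃ s s' u : ℝ,
      leafPeriod s u (transverseWedge w.1) ≠ leafPeriod s' u (transverseWedge w.1) := by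
  obtain ⟨a, b, hab⟩ := h
  obtain ⟨s, rfl⟩ := QuotientAddGroup.mk_surjective a
  obtain ⟨s', rfl⟩ := QuotientAddGroup.mk_surjective b
  refine ⟨s, s', 0, fun heq => hab ?_⟩
  simp only [leafPeriod_transverseWedge_eq_of_cls_eq hw, leafPeriod_transverseWedge_formB] at heq
  have hfg : f s * g 0 = f s' * g 0 := mul_left_cancel₀ (by positivity) heq
  change g 0 * (f s' - f s) = 0
  linear_combination -hfg

lemma kuranishi_formB_ne_zero (h : ∃ a b : S1, g 0 * (f b - f a) ≠ 0) :
    kuranishi (cls ⟨formB f g hf hg, formB_mem_closedHor hf hg⟩) ≠ 0 := by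
  obtain ⟨s, s', u, hne⟩ := exists_leafPeriod_transverseWedge_ne hf hg h rfl
  exact fun h0 => hne (leafPeriod_transverseWedge_eq_of_kuranishi_eq_zero h0 s s' u)

end FormB

/-! ### Formal obstruction -/

lemma kuranishi_eq_zero_of_extendsFormally {w : closedHor eta 2}
    (h : ExtendsFormally eta biv w.1) : kuranishi (cls w) = 0 := by
  obtain ⟨v, ⟨hv0, hvhor, hmc⟩, hv1⟩ := h
  have hmc2 : d (v 2) + (2⁻¹ : ℝ) • lam2 biv w.1 w.1 = 0 := by
    have h := hmc 2
    simp only [lam3_biv, Finset.sum_const_zero, smul_zero, add_zero,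
      Finset.Nat.sum_antidiagonal_eq_sum_range_succ_mk, Finset.sum_range_succ,
      Finset.sum_range_zero, zero_add, Nat.reduceSub, hv0, hv1] at h
    have hleft : lam2 biv (0 : Form 2) (v 2) = 0 := lam2_zero_left biv (v 2)
    have hright : lam2 biv (v 2) (0 : Form 2) = 0 := lam2_zero_right biv (v 2)
    rwa [hleft, hright, zero_add, add_zero] at h
  refine kuranishi_cls_eq_zero_iff.2 ⟨(-2 : ℝ) • v 2, (horForm eta 2).smul_mem _ (hvhor 2), ?_⟩
  rw [map_smul, eq_neg_of_add_eq_zero_left hmc2]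
  module

/-! ### Closed forms attached to Maurer–Cartan elements and pre-symplectic forms -/

lemma IsMC.coeff3_d {β : Form 2} (h : IsMC eta biv β) (i j k : Fin 4) :
    (1 - coeff2 β 2 3) * coeff3 (d β) i j k + coeff3 (d (transverseWedge β)) i j k
      + coeff2 β j k * coeff3 (d β) 3 2 i - coeff2 β i k * coeff3 (d β) 3 2 j
      + coeff2 β i j * coeff3 (d β) 3 2 k = 0 := by
  have hmc : d β + (2⁻¹ : ℝ) • lam2 biv β β = 0 := by
    simpa only [lam3_biv, smul_zero, add_zero] using h.2
  have hcoeff : coeff3 (d β) i j k + (2⁻¹ : ℝ) • coeff3 (lam2 biv β β) i j k = 0 :=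
    congrArg (fun om => coeff3 om i j k) hmc
  rw [coeff3_lam2_self, two_mul, ← two_smul ℝ, inv_smul_smul₀ two_ne_zero] at hcoeff
  linear_combination hcoeff

lemma IsMC.coeff3_d_three_two {β : Form 2} (h : IsMC eta biv β) (i : Fin 4) :
    (1 - coeff2 β 2 3) * coeff3 (d β) 3 2 i
      = coeff2 β 3 i * pder 2 (coeff2 β 2 3) - coeff2 β 2 i * pder 3 (coeff2 β 2 3)
        + coeff2 β 2 3 * pder i (coeff2 β 2 3) := by
  have hmc := h.coeff3_d 3 2 i
  simp only [KoszulTorus.coeff3_d, coeff2_transverseWedge, coeff2_self, coeff2_swap β 3 2, map_sub,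
    map_neg, map_zero, Derivation.leibniz, smul_eq_mul] at hmc ⊢
  linear_combination hmc

-- The wedge product `x ∧ A ∧ A` vanishes for degree reasons; contract it with `∂₃` and `∂₄`.
lemma covector_wedge_wedge_self_contract {R : Type*} [CommRing R] {x : Fin 4 → R}
    {A : Fin 4 → Fin 4 → R} (h : ∀ i, A i i = 0) (hA : ∀ i j, A i j = -A j i) (i j k : Fin 4) :
    x i * (A 2 j * A 3 k - A 2 k * A 3 j - A 2 3 * A j k)
    - x j * (A 2 i * A 3 k - A 2 k * A 3 i - A 2 3 * A i k)
    + x k * (A 2 i * A 3 j - A 2 j * A 3 i - A 2 3 * A i j)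
    = A j k * (A 3 i * x 2 - A 2 i * x 3) - A i k * (A 3 j * x 2 - A 2 j * x 3)
      + A i j * (A 3 k * x 2 - A 2 k * x 3) := by
  have h10 := hA 1 0
  have h20 := hA 2 0
  have h30 := hA 3 0
  have h21 := hA 2 1
  have h31 := hA 3 1
  have h32 := hA 3 2
  fin_cases i <;> fin_cases j <;> fin_cases k <;> simp [h, h10, h20, h30, h21, h31, h32] <;> ring

lemma IsMC.d_add_fmul_transverseWedge_eq_zero {β : Form 2} (h : IsMC eta biv β) {I : smoothFun}
    (hI : (1 - coeff2 β 2 3) * I = 1) : d (β + fmul I (transverseWedge β)) = 0 := by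
  have hpder (l : Fin 4) : pder l I = I ^ 2 * pder l (coeff2 β 2 3) := by
    have hl := congrArg (pder l) hI
    simp only [Derivation.leibniz, map_sub, Derivation.map_one_eq_zero, smul_eq_mul] at hl
    linear_combination I * hl - pder l I * hI
  refine Form.ext_coeff3 fun i j k => ?_
  have hcoeff (i j : Fin 4) : coeff2 (fmul I (transverseWedge β)) i j
      = I * coeff2 (transverseWedge β) i j := rfl
  have hexpand : coeff3 (d (β + fmul I (transverseWedge β))) i j k
      = coeff3 (d β) i j k + I * coeff3 (d (transverseWedge β)) i j k
        + (pder i I * coeff2 (transverseWedge β) j k - pder j I * coeff2 (transverseWedge β) i k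
          + pder k I * coeff2 (transverseWedge β) i j) := by
    simp only [KoszulTorus.coeff3_d, hcoeff, map_add, Derivation.leibniz, smul_eq_mul]
    ring
  have hdegree := covector_wedge_wedge_self_contract (x := fun l => pder l (coeff2 β 2 3))
    (coeff2_self β) (coeff2_swap β) i j k
  refine Eq.trans ?_ (map_zero _).symm
  simp only [hexpand, hpder, coeff2_transverseWedge]
  linear_combination I * h.coeff3_d i j k + I ^ 2 * hdegree
    - I ^ 2 * coeff2 β j k * h.coeff3_d_three_two i
    + I ^ 2 * coeff2 β i k * h.coeff3_d_three_two j
    - I ^ 2 * coeff2 β i j * h.coeff3_d_three_two k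
    + (I * (coeff2 β j k * coeff3 (d β) 3 2 i - coeff2 β i k * coeff3 (d β) 3 2 j
      + coeff2 β i j * coeff3 (d β) 3 2 k) - coeff3 (d β) i j k) * hI

lemma IsMC.leafIntegral_eq {β : Form 2} (h : IsMC eta biv β) {I : smoothFun}
    (hI : (1 - coeff2 β 2 3) * I = 1) (s s' u : ℝ) :
    leafIntegral s u (I * coeff2 (transverseWedge β) 0 1)
      = leafIntegral s' u (I * coeff2 (transverseWedge β) 0 1) := by
  have hclosed := leafPeriod_eq_of_closed (h.d_add_fmul_transverseWedge_eq_zero hI) s s' u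
  rw [map_add, map_add, leafPeriod_of_mem_horForm h.1, leafPeriod_of_mem_horForm h.1, zero_add,
    zero_add] at hclosed
  exact hclosed

lemma pfaffian_mul_eq_zero_of_vecMul_eq_zero {R : Type*} [CommRing R]
    {A : Matrix (Fin 4) (Fin 4) R} (hdiag : ∀ i, A i i = 0) (hA : ∀ i j, A i j = -A j i)
    {v : Fin 4 → R} (hv : v ᵥ* A = 0) (i : Fin 4) :
    (A 0 1 * A 2 3 - (A 0 2 * A 1 3 - A 0 3 * A 1 2)) * v i = 0 := by
  have hcol (j : Fin 4) : v 0 * A 0 j + v 1 * A 1 j + v 2 * A 2 j + v 3 * A 3 j = 0 := by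
    simpa [Matrix.vecMul, dotProduct, Fin.sum_univ_four] using congrFun hv j
  have h0 := hcol 0
  have h1 := hcol 1
  have h2 := hcol 2
  have h3 := hcol 3
  rw [hdiag, hA 1 0, hA 2 0, hA 3 0] at h0
  rw [hdiag, hA 2 1, hA 3 1] at h1
  rw [hdiag, hA 3 2] at h2
  rw [hdiag] at h3
  fin_cases i
  · change _ * v 0 = 0
    linear_combination A 2 3 * h1 - A 1 3 * h2 + A 1 2 * h3
  · change _ * v 1 = 0
    linear_combination -A 2 3 * h0 + A 0 3 * h2 - A 0 2 * h3
  · change _ * v 2 = 0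
    linear_combination A 1 3 * h0 - A 0 3 * h1 + A 0 1 * h3
  · change _ * v 3 = 0
    linear_combination -A 1 2 * h0 + A 0 2 * h1 - A 0 1 * h2

lemma IsPreSymplectic.coeff2_zero_one_mul_coeff2_two_three {ζ : Form 2}
    (h : IsPreSymplectic 2 ζ) :
    coeff2 ζ 0 1 * coeff2 ζ 2 3 = coeff2 (transverseWedge ζ) 0 1 := by
  refine smoothFun_ext fun x => ?_
  by_contra hne
  let A : Matrix (Fin 4) (Fin 4) ℝ := .of fun i j => (coeff2 ζ i j).1 (proj x)
  have hpf : A 0 1 * A 2 3 - (A 0 2 * A 1 3 - A 0 3 * A 1 2) ≠ 0 := by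
    have htw : coeff2 (transverseWedge ζ) 0 1
        = coeff2 ζ 0 2 * coeff2 ζ 1 3 - coeff2 ζ 0 3 * coeff2 ζ 1 2 := by
      rw [coeff2_transverseWedge, coeff2_swap ζ 2 0, coeff2_swap ζ 3 1, coeff2_swap ζ 2 1,
        coeff2_swap ζ 3 0]
      ring
    exact fun h0 => hne ((sub_eq_zero.1 h0).trans (congrArg (fun f => f.1 (proj x)) htw).symm)
  have hker : LinearMap.ker (flat ζ (proj x)) = ⊥ := by
    refine LinearMap.ker_eq_bot'.2 fun v hv => funext fun i => ?_
    refine (mul_eq_zero.1 (pfaffian_mul_eq_zero_of_vecMul_eq_zero (A := A)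
      (fun i => ?_) (fun i j => ?_) (funext fun j => ?_) i)).resolve_left hpf
    · exact congrArg (fun f : smoothFun => f.1 (proj x)) (coeff2_self ζ i)
    · exact congrArg (fun f : smoothFun => f.1 (proj x)) (coeff2_swap ζ i j)
    · have hflat (i j : Fin 4) : flat ζ (proj x) (e i) (e j) = A i j := flat_apply ..
      have hsum : v = ∑ i, v i • e i := (pi_eq_sum_univ' v).trans rfl
      have hvj := congrArg (fun l => l (e j)) hv
      rw [hsum] at hvj
      simpa [Matrix.vecMul, dotProduct, hflat, Fin.sum_univ_four] using hvj
  have hrank := LinearMap.finrank_range_add_finrank_ker (flat ζ (proj x))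
  rw [hker, h.2, finrank_bot, Module.finrank_fin_fun] at hrank
  norm_num at hrank

lemma IsPreSymplectic.leafIntegral_eq {ζ : Form 2} (h : IsPreSymplectic 2 ζ) {I : smoothFun}
    (hI : coeff2 ζ 2 3 * I = 1) (s s' u : ℝ) :
    leafIntegral s u (I * coeff2 (transverseWedge ζ) 0 1)
      = leafIntegral s' u (I * coeff2 (transverseWedge ζ) 0 1) := by
  have hcoeff : I * coeff2 (transverseWedge ζ) 0 1 = coeff2 ζ 0 1 := by
    linear_combination -I * h.coeff2_zero_one_mul_coeff2_two_three + coeff2 ζ 0 1 * hI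
  rw [hcoeff]
  exact leafPeriod_eq_of_closed h.1 s s' u

/-! ### Smooth families -/

lemma exists_proj_eq_mem_box (q : T4) :
    ∃ x ∈ Set.Icc (0 : V) (fun _ => 2 * Real.pi), proj x = q := by
  have : Fact (0 < 2 * Real.pi) := ⟨Real.two_pi_pos⟩
  have hcoord (i : Fin 4) : q i ∈ ((↑) '' Set.Icc 0 (0 + 2 * Real.pi) : Set S1) :=
    (AddCircle.coe_image_Icc_eq (2 * Real.pi) 0).symm ▸ Set.mem_univ _
  choose x hx hq using hcoord
  exact ⟨x, ⟨fun i => (hx i).1, fun i => (hx i).2.trans_eq (zero_add _)⟩, funext hq⟩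

lemma abs_alt_two_le (a : Alt 2) (i j : Fin 4) : |a ![e i, e j]| ≤ ‖a‖ := by
  have he (i : Fin 4) : ‖e i‖ = 1 := by rw [e, Pi.norm_single, norm_one]
  simpa [Fin.prod_univ_two, he] using a.le_opNorm ![e i, e j]

lemma exists_mul_eq_one {f : smoothFun} (h : ∀ q, f.1 q ≠ 0) : ∃ g : smoothFun, f * g = 1 :=
  ⟨⟨fun q => (f.1 q)⁻¹, ContDiff.inv (n := ∞) f.2 fun x => h (proj x)⟩,
    smoothFun_ext fun x => mul_inv_cancel₀ (h (proj x))⟩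

section SmoothFamily

open Filter Topology

variable {ε : ℝ} {F : ℝ → Form 2} {w : Form 2}

lemma IsSmoothFamily.exists_lipschitz (hF : IsSmoothFamily ε F w) (hε : 0 < ε) :
    ∃ K : ℝ, 0 ≤ K ∧ ∀ᶠ t in 𝓝[>] 0, ∀ (q : T4) (i j : Fin 4),
      |(coeff2 (F t) i j).1 q - (coeff2 (F 0) i j).1 q| ≤ K * t := by
  let S : Set (ℝ × V) := Set.Icc 0 (ε / 2) ×ˢ Set.Icc (0 : V) (fun _ => 2 * Real.pi)
  have hS : S ⊆ Set.Ico 0 ε ×ˢ Set.univ :=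
    Set.prod_mono (Set.Icc_subset_Ico_right (half_lt_self hε)) (Set.subset_univ _)
  obtain ⟨K, hK⟩ := (hF.1.mono hS).exists_lipschitzOnWith (by simp)
    ((convex_Icc _ _).prod (convex_Icc _ _)) (isCompact_Icc.prod isCompact_Icc)
  refine ⟨K, K.2, ?_⟩
  filter_upwards [Ioc_mem_nhdsGT (half_pos hε)] with t ht q i j
  obtain ⟨x, hx, rfl⟩ := exists_proj_eq_mem_box q
  have h := hK.norm_sub_le (x := (t, x)) (y := (0, x)) ⟨Set.Ioc_subset_Icc_self ht, hx⟩
    ⟨⟨le_rfl, (half_pos hε).le⟩, hx⟩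
  have hnorm : ‖((t, x) : ℝ × V) - (0, x)‖ = t := by
    simp [Prod.norm_def, abs_of_pos ht.1, ht.1.le]
  rw [hnorm] at h
  exact (abs_alt_two_le _ i j).trans h

lemma IsSmoothFamily.tendstoUniformly_coeff2 (hF : IsSmoothFamily ε F w) (hε : 0 < ε)
    (i j : Fin 4) :
    TendstoUniformly (fun t => (coeff2 (F t) i j).1) (coeff2 (F 0) i j).1 (𝓝[>] 0) := by
  obtain ⟨K, -, hK⟩ := hF.exists_lipschitz hε
  refine Metric.tendstoUniformly_iff.2 fun δ hδ => ?_
  have hlim : Tendsto (fun t : ℝ => K * t) (𝓝[>] 0) (𝓝 0) :=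
    ((continuous_const_mul K).tendsto' 0 0 (mul_zero K)).mono_left nhdsWithin_le_nhds
  filter_upwards [hK, hlim.eventually_lt_const hδ] with t ht htδ q
  rw [dist_comm, Real.dist_eq]
  exact (ht q i j).trans_lt htδ

lemma IsSmoothFamily.tendsto_coeff2_div (hF : IsSmoothFamily ε F w) {i j : Fin 4}
    (h0 : coeff2 (F 0) i j = 0) (q : T4) :
    Tendsto (fun t => (coeff2 (F t) i j).1 q / t) (𝓝[>] 0) (𝓝 ((coeff2 w i j).1 q)) := by
  have h : HasDerivWithinAt (fun t => (coeff2 (F t) i j).1 q) ((coeff2 w i j).1 q) (Set.Ici 0) 0 :=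
    (ContinuousAlternatingMap.apply ℝ V ℝ ![e i, e j]).hasFDerivAt.comp_hasDerivWithinAt 0 (hF.2 q)
  rw [hasDerivWithinAt_iff_tendsto_slope, Set.Ici_sdiff_left] at h
  refine h.congr fun t => ?_
  rw [slope_def_field, h0]
  exact congrArg₂ (· / ·) (sub_zero _) (sub_zero t)

lemma IsSmoothFamily.tendsto_coeff2_transverseWedge_div_sq (hF : IsSmoothFamily ε F w)
    {j k : Fin 4} (hj : ∀ i, coeff2 (F 0) i j = 0) (hk : ∀ i, coeff2 (F 0) i k = 0) (q : T4) :
    Tendsto (fun t => (coeff2 (transverseWedge (F t)) j k).1 q / t ^ 2) (𝓝[>] 0)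
      (𝓝 ((coeff2 (transverseWedge w) j k).1 q)) := by
  have hlim := ((hF.tendsto_coeff2_div (hj 2) q).mul (hF.tendsto_coeff2_div (hk 3) q)).sub
    ((hF.tendsto_coeff2_div (hk 2) q).mul (hF.tendsto_coeff2_div (hj 3) q))
  simp only [coeff2_transverseWedge]
  refine hlim.congr fun t => ?_
  rw [div_mul_div_comm, div_mul_div_comm, ← sub_div, ← sq]
  rfl

lemma IsSmoothFamily.exists_abs_coeff2_transverseWedge_le (hF : IsSmoothFamily ε F w)
    (hε : 0 < ε) {j k : Fin 4} (hj : ∀ i, coeff2 (F 0) i j = 0)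
    (hk : ∀ i, coeff2 (F 0) i k = 0) :
    ∃ C : ℝ, ∀ᶠ t in 𝓝[>] 0, ∀ q, |(coeff2 (transverseWedge (F t)) j k).1 q / t ^ 2| ≤ C := by
  obtain ⟨K, hK0, hK⟩ := hF.exists_lipschitz hε
  refine ⟨K ^ 2 + K ^ 2, ?_⟩
  filter_upwards [hK, self_mem_nhdsWithin] with t ht ht0 q
  have hcoeff {i l : Fin 4} (h0 : coeff2 (F 0) i l = 0) :
      |(coeff2 (F t) i l).1 q / t| ≤ K := by
    rw [abs_div, abs_of_pos (Set.mem_Ioi.1 ht0), div_le_iff₀ ht0]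
    have h := ht q i l
    rw [h0] at h
    exact (congrArg abs (sub_zero _)).symm.trans_le h
  have hmul {x y : ℝ} (hx : |x| ≤ K) (hy : |y| ≤ K) : |x * y| ≤ K ^ 2 := by
    rw [abs_mul, sq]
    exact mul_le_mul hx hy (abs_nonneg _) hK0
  have hsplit : (coeff2 (transverseWedge (F t)) j k).1 q / t ^ 2
      = (coeff2 (F t) 2 j).1 q / t * ((coeff2 (F t) 3 k).1 q / t)
        - (coeff2 (F t) 2 k).1 q / t * ((coeff2 (F t) 3 j).1 q / t) := by
    rw [coeff2_transverseWedge, div_mul_div_comm, div_mul_div_comm, ← sub_div, ← sq]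
    rfl
  rw [hsplit]
  exact (abs_sub _ _).trans (add_le_add (hmul (hcoeff (hj 2)) (hcoeff (hk 3)))
    (hmul (hcoeff (hk 2)) (hcoeff (hj 3))))

lemma exists_eventually_mul_eq_one {ι : Type*} {l : Filter ι} {D : ι → smoothFun}
    (hD : TendstoUniformly (fun t => (D t).1) 1 l) :
    ∃ I : ι → smoothFun, (∀ᶠ t in l, D t * I t = 1) ∧ (∀ᶠ t in l, ∀ q, |(I t).1 q| ≤ 2) ∧
      ∀ q, Tendsto (fun t => (I t).1 q) l (𝓝 1) := by
  have hlower : ∀ᶠ t in l, ∀ q, 1 / 2 < (D t).1 q := by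
    filter_upwards [Metric.tendstoUniformly_iff.1 hD (1 / 2) (by norm_num)] with t ht q
    have hq : |1 - (D t).1 q| < 1 / 2 := ht q
    linarith [(abs_lt.1 hq).2]
  have hex (t : ι) : ∃ I : smoothFun, (∀ q, 1 / 2 < (D t).1 q) → D t * I = 1 := by
    by_cases ht : ∀ q, 1 / 2 < (D t).1 q
    · obtain ⟨I, hI⟩ := exists_mul_eq_one fun q => (one_half_pos.trans (ht q)).ne'
      exact ⟨I, fun _ => hI⟩
    · exact ⟨0, fun h => absurd h ht⟩
  choose I hI using hex
  have hinv : ∀ᶠ t in l, ∀ q, ((D t).1 q)⁻¹ = (I t).1 q := hlower.mono fun t ht q =>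
    (eq_inv_of_mul_eq_one_right (congrArg (fun f => f.1 q) (hI t ht))).symm
  refine ⟨I, hlower.mono hI, ?_, fun q => ?_⟩
  · filter_upwards [hlower, hinv] with t ht htI q
    rw [← htI, abs_inv, abs_of_pos (one_half_pos.trans (ht q)), ← inv_inv (2 : ℝ), ← one_div 2]
    exact inv_anti₀ one_half_pos (ht q).le
  · simpa using ((hD.tendsto_at q).inv₀ one_ne_zero).congr' (hinv.mono fun t ht => ht q)

lemma tendsto_leafIntegral {ι : Type*} {l : Filter ι} [l.IsCountablyGenerated]
    {f : ι → smoothFun} {g : smoothFun} {C : ℝ} (hC : ∀ᶠ t in l, ∀ q, |(f t).1 q| ≤ C)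
    (hlim : ∀ q, Tendsto (fun t => (f t).1 q) l (𝓝 (g.1 q))) (s u : ℝ) :
    Tendsto (fun t => leafIntegral s u (f t)) l (𝓝 (leafIntegral s u g)) :=
  MeasureTheory.tendsto_integral_filter_of_dominated_convergence (fun _ => C)
    (.of_forall fun t => (continuous_leaf (f t) s u).aestronglyMeasurable)
    (hC.mono fun _ ht => .of_forall fun _ => ht _)
    (continuousOn_const.integrableOn_compact isCompact_leafBox) (.of_forall fun _ => hlim _)

lemma IsSmoothFamily.tendsto_leafIntegral_div_sq (hF : IsSmoothFamily ε F w) (hε : 0 < ε)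
    (h0 : ∀ i, coeff2 (F 0) i 0 = 0) (h1 : ∀ i, coeff2 (F 0) i 1 = 0) {I : ℝ → smoothFun} {C : ℝ}
    (hC : ∀ᶠ t in 𝓝[>] 0, ∀ q, |(I t).1 q| ≤ C)
    (hI : ∀ q, Tendsto (fun t => (I t).1 q) (𝓝[>] 0) (𝓝 1)) (s u : ℝ) :
    Tendsto (fun t => leafIntegral s u (I t * coeff2 (transverseWedge (F t)) 0 1) / t ^ 2) (𝓝[>] 0)
      (𝓝 (leafPeriod s u (transverseWedge w))) := by
  obtain ⟨C', hC'⟩ := hF.exists_abs_coeff2_transverseWedge_le hε h0 h1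
  have hscale (t : ℝ) (q : T4) :
      ((t ^ 2)⁻¹ • (I t * coeff2 (transverseWedge (F t)) 0 1)).1 q
        = (I t).1 q * ((coeff2 (transverseWedge (F t)) 0 1).1 q / t ^ 2) := by
    change (t ^ 2)⁻¹ * ((I t).1 q * (coeff2 (transverseWedge (F t)) 0 1).1 q) = _
    ring
  have hlim : Tendsto
      (fun t => leafIntegral s u ((t ^ 2)⁻¹ • (I t * coeff2 (transverseWedge (F t)) 0 1))) (𝓝[>] 0)
      (𝓝 (leafPeriod s u (transverseWedge w))) := by
    refine tendsto_leafIntegral (C := C * C') ?_ (fun q => ?_) s u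
    · filter_upwards [hC, hC'] with t ht ht' q
      rw [hscale, abs_mul]
      exact mul_le_mul (ht q) (ht' q) (abs_nonneg _) ((abs_nonneg _).trans (ht q))
    · simp only [hscale]
      simpa using (hI q).mul (hF.tendsto_coeff2_transverseWedge_div_sq h0 h1 q)
  exact hlim.congr fun t => by rw [map_smul, smul_eq_mul, inv_mul_eq_div]

lemma IsSmoothFamily.leafPeriod_transverseWedge_eq (hF : IsSmoothFamily ε F w) (hε : 0 < ε)
    (h0 : ∀ i, coeff2 (F 0) i 0 = 0) (h1 : ∀ i, coeff2 (F 0) i 1 = 0) {D : ℝ → smoothFun}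
    (hD : TendstoUniformly (fun t => (D t).1) 1 (𝓝[>] 0)) {s s' u : ℝ}
    (h : ∀ t ∈ Set.Ico 0 ε, ∀ I : smoothFun, D t * I = 1 →
      leafIntegral s u (I * coeff2 (transverseWedge (F t)) 0 1)
        = leafIntegral s' u (I * coeff2 (transverseWedge (F t)) 0 1)) :
    leafPeriod s u (transverseWedge w) = leafPeriod s' u (transverseWedge w) := by
  obtain ⟨I, hDI, hbound, hI⟩ := exists_eventually_mul_eq_one hD
  refine tendsto_nhds_unique (hF.tendsto_leafIntegral_div_sq hε h0 h1 hbound hI s u)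
    ((hF.tendsto_leafIntegral_div_sq hε h0 h1 hbound hI s' u).congr' ?_)
  filter_upwards [hDI, Ioo_mem_nhdsGT hε] with t htI ht
  rw [h t (Set.Ioo_subset_Ico_self ht) (I t) htI]

lemma leafPeriod_transverseWedge_eq_of_extendsSmoothly (h : ExtendsSmoothly eta biv w)
    (s s' u : ℝ) : leafPeriod s u (transverseWedge w) = leafPeriod s' u (transverseWedge w) := by
  obtain ⟨ε, hε, β, hβ, hβ0, hMC⟩ := h
  have hzero (i j : Fin 4) : coeff2 (β 0) i j = 0 := by
    rw [hβ0]
    exact map_zero _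
  have hD : TendstoUniformly (fun t => (1 - coeff2 (β t) 2 3).1) 1 (𝓝[>] 0) := by
    have hβ' := hβ.tendstoUniformly_coeff2 hε 2 3
    rw [hzero, Metric.tendstoUniformly_iff] at hβ'
    refine Metric.tendstoUniformly_iff.2 fun δ hδ => (hβ' δ hδ).mono fun t ht q => ?_
    refine (Eq.trans ?_ (dist_sub_left 1 _ _)).trans_lt (ht q)
    exact congrArg (dist · _) (sub_zero 1).symm
  exact hβ.leafPeriod_transverseWedge_eq hε (fun i => hzero i 0) (fun i => hzero i 1) hD
    fun t ht I hI => (hMC t ht).leafIntegral_eq hI s s' u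

lemma leafPeriod_transverseWedge_eq_of_isPreSymplecticVelocity
    (h : IsPreSymplecticVelocity 2 eta w) (s s' u : ℝ) :
    leafPeriod s u (transverseWedge w) = leafPeriod s' u (transverseWedge w) := by
  obtain ⟨ε, hε, ζ, hζ, hζ0, hpre⟩ := h
  have hcoeff (i j : Fin 4) :
      coeff2 (ζ 0) i j = algebraMap ℝ smoothFun (dθ2 2 3 ![e i, e j]) := by
    rw [hζ0]
    rfl
  have hD := hζ.tendstoUniformly_coeff2 hε 2 3
  have hone : coeff2 (ζ 0) 2 3 = 1 := by simp [hcoeff, dθ2_apply, e_apply]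
  rw [hone] at hD
  exact hζ.leafPeriod_transverseWedge_eq hε (fun i => by simp [hcoeff, dθ2_apply, e_apply])
    (fun i => by simp [hcoeff, dθ2_apply, e_apply]) hD
    fun t ht I hI => (hpre t ht).leafIntegral_eq hI s s' u

end SmoothFamily

/-! ### Obstructed deformations -/

lemma not_extends_of_cls_eq_formB {f g : S1 → ℝ} (hf : IsSmoothS1 f) (hg : IsSmoothS1 g)
    (h : ∃ a b : S1, g 0 * (f b - f a) ≠ 0) {w : closedHor eta 2}
    (hw : cls w = cls ⟨formB f g hf hg, formB_mem_closedHor hf hg⟩) :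
    ¬ ExtendsFormally eta biv w.1 ∧ ¬ ExtendsSmoothly eta biv w.1 ∧
      ¬ IsPreSymplecticVelocity 2 eta w.1 := by
  obtain ⟨s, s', u, hne⟩ := exists_leafPeriod_transverseWedge_ne hf hg h hw
  exact ⟨fun hext => kuranishi_formB_ne_zero hf hg h
      (hw ▸ kuranishi_eq_zero_of_extendsFormally hext),
    fun hext => hne (leafPeriod_transverseWedge_eq_of_extendsSmoothly hext s s' u),
    fun hext => hne (leafPeriod_transverseWedge_eq_of_isPreSymplecticVelocity hext s s' u)⟩

lemma cosS1_coe (t : ℝ) : cosS1 (t : S1) = Real.cos t := rfl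

lemma exists_cosS1_zero_mul_sub_ne_zero : ∃ a b : S1, cosS1 0 * (cosS1 b - cosS1 a) ≠ 0 := by
  refine ⟨((0 : ℝ) : S1), (Real.pi : S1), ?_⟩
  rw [← AddCircle.coe_zero, cosS1_coe, cosS1_coe, Real.cos_zero, Real.cos_pi]
  norm_num

end KoszulTorus

end

theorem mainTheorem10 :
    -- `η = dθ₃ ∧ dθ₄` is pre-symplectic of rank 2, with kernel spanned by `∂/∂θ₁`, `∂/∂θ₂`,
    -- and `π = ∂/∂θ₃ ∧ ∂/∂θ₄` is the bivector field belonging to `η` and `G`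
    IsPreSymplectic 2 eta ∧
    (∀ q, kerAt eta q = Submodule.span ℝ {e 0, e 1}) ∧
    IsNegInverse eta G34 biv ∧
    -- the Kuranishi map `[w] ↦ [λ₂(w,w)]` is well defined
    (∃ Kr : HHor eta 1 → HHor eta 2,
      (∀ w : closedHor eta 2, ∃ h : lam2 biv w.1 w.1 ∈ closedHor eta 3,
        Kr (cls w) = cls ⟨lam2 biv w.1 w.1, h⟩) ∧
      -- the forms `B = f(θ₃) dθ₁ ∧ dθ₃ + g(θ₄) dθ₂ ∧ dθ₄`
      (∀ (f g : S1 → ℝ) (hf : IsSmoothS1 f) (hg : IsSmoothS1 g),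
        (∃ hB : formB f g hf hg ∈ closedHor eta 2,
          (∃ a b : S1, g 0 * (f b - f a) ≠ 0) →
            Kr (cls ⟨formB f g hf hg, hB⟩) ≠ 0) ∧
        lam2 biv (formB f g hf hg) (formB f g hf hg)
          = koszul biv (formB f g hf hg) (formB f g hf hg) ∧
        (∀ x : V, (koszul biv (formB f g hf hg) (formB f g hf hg)).1 (proj x)
          = (2 : ℝ) • ((f (x 2) * deriv (fun t : ℝ => g t) (x 3)) • dθ3 0 1 3
            + (g (x 3) * deriv (fun t : ℝ => f t) (x 2)) • dθ3 0 1 2)) ∧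
        ∃ α : Form 2, d α = koszul biv (formB f g hf hg) (formB f g hf hg)) ∧
      -- the case `f = g = cos`
      ∃ hB : formB cosS1 cosS1 cosS1_smooth cosS1_smooth ∈ closedHor eta 2,
        Kr (cls ⟨formB cosS1 cosS1 cosS1_smooth cosS1_smooth, hB⟩) ≠ 0 ∧
        ∀ w : closedHor eta 2,
          cls w = cls ⟨formB cosS1 cosS1 cosS1_smooth cosS1_smooth, hB⟩ →
            ¬ ExtendsFormally eta biv w.1 ∧
            ¬ ExtendsSmoothly eta biv w.1 ∧
            ¬ IsPreSymplecticVelocity 2 eta w.1) := by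
  refine ⟨isPreSymplectic_eta, kerAt_eta, isNegInverse_biv, kuranishi,
    fun w => ⟨lam2_mem_closedHor w, kuranishi_cls w⟩, fun f g hf hg => ?_,
    formB_mem_closedHor cosS1_smooth cosS1_smooth,
    kuranishi_formB_ne_zero _ _ exists_cosS1_zero_mul_sub_ne_zero,
    fun w hw => not_extends_of_cls_eq_formB _ _ exists_cosS1_zero_mul_sub_ne_zero hw⟩
  refine ⟨⟨formB_mem_closedHor hf hg, kuranishi_formB_ne_zero hf hg⟩, lam2_eq_koszul _ _,
    koszul_formB hf hg, (2 : ℝ) • transverseWedge (formB f g hf hg), ?_⟩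
  rw [← lam2_eq_koszul, lam2_self_eq_d_transverseWedge (formB_mem_closedHor hf hg).2, map_smul]
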